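/- Let $H$ be a complex Hilbert space and let $A$ be a diagonal parabolic operator on $H$: there is an orthonormal basis $(e_n)_{n\ge1}$ of $H$ with $Ae_n=\lambda_ne_n$, the domain is $D(A)=\{x\in H : \sum_n|\lambda_n\langle x,e_n\rangle|^2<\infty\}$ with $Ax=\sum_n\lambda_n\langle x,e_n\rangle e_n$, the sequence $(\operatorname{Re}\lambda_n)$ is non-increasing and tends to $-\infty$, and there is $C>0$ with $|\operatorname{Re}\lambda_n|\ge C|\operatorname{Im}\lambda_n|$ for all $n$. Give $D(A)$ the graph inner product, let $D(A)\subset H\subset D(A)'$ be the associated Gelfand triple, with bracket $\langle\cdot,\cdot\rangle_{D(A)',D(A)}$ linear in the first and antilinear in the second argument, and let $A$ also denote its extension to a bounded operator $H\to D(A)'$. Let $\lambda>0$. Put $L_\lambda=\operatorname{span}\{e_n:\operatorname{Re}\lambda_n\ge-\lambda\}$, let $H_\lambda$ and $D(A)'_\lambda$ be the closures of $\operatorname{span}\{e_n:\operatorname{Re}\lambda_n<-\lambda\}$ in $H$ and in $D(A)'$, let $A_H:H_\lambda\to D(A)'_\lambda$ be the restriction of $A$, and let $m(\lambda)$ be the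 greatest multiplicity of an eigenvalue $\lambda_n$ of $A$ with $\operatorname{Re}\lambda_n\ge-\lambda$. Fix a partition of $(e_n)$ into $m(\lambda)$ sequences $(e^j_k)_{k\ge1}$, $1\le j\le m(\lambda)$, and integers $N_j\ge1$, such that $\{e_k^j:1\le j\le m(\lambda),\,1\le k\le N_j\}=\{e_n:\operatorname{Re}\lambda_n\ge-\lambda\}$ and such that, for each $j$, the eigenvalues of $e^j_1,\dots,e^j_{N_j}$ are pairwise distinct. Let $B=(B_1,\dots,B_{m(\lambda)})\in(D(A)')^{m(\lambda)}$ be $F_\lambda$-admissible: for every $j$, $B_j$ vanishes on all elements of $D(A)$ orthogonal in $H$ to the sequence $(e^j_k)_{k\ge1}$, and $\langle B_j,e^j_k\rangle_{D(A)',D(A)}\ne0$ for $1\le k\le N_j$. Let $B_{j,H}\in D(A)'_\lambda$ be the orthogonal projection of $B_j$ onto $D(A)'_\lambda$. Let $C(A_H)$ be the set of bounded linear operators $M$ on $D(A)'_\lambda$ that restrict to a bounded operator on $H_\lambda$ and satisfy $A_HM=MA_H$ as operators from $H_\lambda$ to $D(A)'_\lambda$, and let $$N_{B_H}=\{M\in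 C(A_H) : MB_{j,H}=0\text{ for all }1\le j\le m(\lambda)\}.$$ Then, for every $\tau>0$, $N_{B_H}=\{0\}$ if and only if $(A,B)$ is approximately controllable in time $\tau$, that is: for all $u_0,u_1\in H$ and $\varepsilon>0$ there is $w\in L^2(0,\tau;\mathbb C^{m(\lambda)})$ such that the solution $u\in C([0,\tau];D(A)')$ of $\partial_tu=Au+\sum_jw_jB_j$, $u(0)=u_0$, satisfies $u(\tau)\in H$ and $\|u(\tau)-u_1\|_H\le\varepsilon$. Here the equation is understood weakly: for every $\varphi\in D(A)$ with $A^*\varphi\in D(A)$ and every $t\in[0,\tau]$, $$\langle u(t),\varphi\rangle=\langle u_0,\varphi\rangle+\int_0^t\Big(\langle u(s),A^*\varphi\rangle+\sum_jw_j(s)\langle B_j,\varphi\rangle\Big)\,ds .$$ -/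

import Mathlib

open scoped ComplexConjugate

set_option linter.unusedSectionVars false

noncomputable section

/-- A diagonal parabolic operator on the complex Hilbert space `H`: an unbounded operator `op` with
an orthonormal (Hilbert) basis `e 0, e 1, …` of eigenvectors, `op (e n) = ev n • e n`, whose domain
is `{x | op x ∈ H}`, i.e. `x` lies in the domain, with `op x = y`, exactly when the formal series
`∑ ev n ⟨x, e n⟩ e n` is the vector `y` of `H`. The real parts of the eigenvalues are non-increasing
and tend to `-∞`, and the eigenvalues lie in a sector. -/
structure DiagonalParabolic (H : Type*) [NormedAddCommGroup H] [InnerProductSpace ℂ H] where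
  op : H →ₗ.[ℂ] H
  e : HilbertBasis ℕ ℂ H
  ev : ℕ → ℂ
  mem_graph_iff : ∀ x y : H,
    (x, y) ∈ op.graph ↔ ∀ n, inner ℂ (e n) y = ev n * inner ℂ (e n) x
  antitone_re : Antitone fun n => (ev n).re
  tendsto_re : Filter.Tendsto (fun n => (ev n).re) Filter.atTop Filter.atBot
  sector : ∃ C : ℝ, 0 < C ∧ ∀ n, C * |(ev n).im| ≤ |(ev n).re|

namespace DiagonalParabolic

variable {H : Type*} [NormedAddCommGroup H] [InnerProductSpace ℂ H]

/-- The Hilbert space `D(A)` with the inner product `⟨x, y⟩ + ⟨A x, A y⟩`, realized as the graph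
`{(x, A x)}` of `A` inside the Hilbert sum of two copies of `H`. -/
def domSubmodule (A : DiagonalParabolic H) : Submodule ℂ (WithLp 2 (H × H)) :=
  A.op.graph.comap (WithLp.linearEquiv 2 ℂ (H × H)).toLinearMap

abbrev Dom (A : DiagonalParabolic H) : Type _ := A.domSubmodule

/-- `D(A)'`: the bounded antilinear functionals on `D(A)`, with the operator norm. The bracket
`⟨f, φ⟩` of `D(A)'` and `D(A)` is `f φ`, linear in `f` and antilinear in `φ`. -/
abbrev Dual (A : DiagonalParabolic H) : Type _ := A.Dom →L⋆[ℂ] ℂ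

/-- The inclusion `D(A) → H`. -/
def toH (A : DiagonalParabolic H) : A.Dom →ₗ[ℂ] H where
  toFun φ := (φ : WithLp 2 (H × H)).fst
  map_add' _ _ := rfl
  map_smul' _ _ := rfl

/-- The operator `A : D(A) → H`. -/
def toImage (A : DiagonalParabolic H) : A.Dom →ₗ[ℂ] H where
  toFun φ := (φ : WithLp 2 (H × H)).snd
  map_add' _ _ := rfl
  map_smul' _ _ := rfl

theorem graph_mem (A : DiagonalParabolic H) (φ : A.Dom) :
    (A.toH φ, A.toImage φ) ∈ A.op.graph := φ.2

theorem toH_mem (A : DiagonalParabolic H) (φ : A.Dom) : A.toH φ ∈ A.op.domain :=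
  LinearPMap.mem_domain_of_mem_graph (A.graph_mem φ)

theorem toImage_eq (A : DiagonalParabolic H) (φ : A.Dom) :
    A.toImage φ = A.op ⟨A.toH φ, A.toH_mem φ⟩ :=
  A.op.mem_graph_snd_inj (A.graph_mem φ) (A.op.mem_graph ⟨A.toH φ, A.toH_mem φ⟩) rfl

theorem inner_toImage (A : DiagonalParabolic H) (φ : A.Dom) (n : ℕ) :
    inner ℂ (A.e n) (A.toImage φ) = A.ev n * inner ℂ (A.e n) (A.toH φ) :=
  (A.mem_graph_iff _ _).1 (A.graph_mem φ) n

theorem inner_dom (A : DiagonalParabolic H) (φ ψ : A.Dom) :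
    inner ℂ φ ψ = inner ℂ (A.toH φ) (A.toH ψ) + inner ℂ (A.toImage φ) (A.toImage ψ) := rfl

theorem norm_sq_dom (A : DiagonalParabolic H) (φ : A.Dom) :
    ‖φ‖ ^ 2 = ‖A.toH φ‖ ^ 2 + ‖A.toImage φ‖ ^ 2 :=
  WithLp.prod_norm_sq_eq_of_L2 (φ : WithLp 2 (H × H))

theorem norm_toH_le (A : DiagonalParabolic H) (φ : A.Dom) : ‖A.toH φ‖ ≤ ‖φ‖ := by
  have h := A.norm_sq_dom φ
  exact le_of_sq_le_sq (by nlinarith [sq_nonneg ‖A.toImage φ‖]) (norm_nonneg _)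

theorem norm_toImage_le (A : DiagonalParabolic H) (φ : A.Dom) : ‖A.toImage φ‖ ≤ ‖φ‖ := by
  have h := A.norm_sq_dom φ
  exact le_of_sq_le_sq (by nlinarith [sq_nonneg ‖A.toH φ‖]) (norm_nonneg _)

theorem ext_coeff (A : DiagonalParabolic H) {x y : H}
    (h : ∀ n, inner ℂ (A.e n) x = inner ℂ (A.e n) y) : x = y := by
  apply A.e.repr.injective
  ext n
  simpa [HilbertBasis.repr_apply_apply] using h n

theorem graph_e (A : DiagonalParabolic H) (n : ℕ) : (A.e n, A.ev n • A.e n) ∈ A.op.graph := by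
  rw [A.mem_graph_iff]
  intro k
  rw [inner_smul_right]
  rcases eq_or_ne k n with rfl | hkn
  · rfl
  · rw [A.e.orthonormal.2 hkn, mul_zero, mul_zero]

/-- The eigenvector `e n` as an element of `D(A)`. -/
def eDom (A : DiagonalParabolic H) (n : ℕ) : A.Dom :=
  ⟨WithLp.toLp 2 (A.e n, A.ev n • A.e n), A.graph_e n⟩

theorem toH_eDom (A : DiagonalParabolic H) (n : ℕ) : A.toH (A.eDom n) = A.e n := rfl

theorem toImage_eDom (A : DiagonalParabolic H) (n : ℕ) :
    A.toImage (A.eDom n) = A.ev n • A.e n := rfl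

theorem e_mem_domain (A : DiagonalParabolic H) (n : ℕ) : A.e n ∈ A.op.domain :=
  LinearPMap.mem_domain_of_mem_graph (A.graph_e n)

theorem dense_domain (A : DiagonalParabolic H) : Dense (A.op.domain : Set H) := by
  rw [Submodule.dense_iff_topologicalClosure_eq_top, eq_top_iff, ← A.e.dense_span]
  refine Submodule.topologicalClosure_mono (Submodule.span_le.2 ?_)
  rintro _ ⟨n, rfl⟩
  exact A.e_mem_domain n

instance instCompleteSpaceDom [CompleteSpace H] (A : DiagonalParabolic H) :
    CompleteSpace A.Dom := by
  have hset : (A.domSubmodule : Set (WithLp 2 (H × H))) =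
      ⋂ n, {p | inner ℂ (A.e n) p.snd = A.ev n * inner ℂ (A.e n) p.fst} := by
    ext p
    rw [Set.mem_iInter]
    exact A.mem_graph_iff p.fst p.snd
  have hcl : IsClosed (A.domSubmodule : Set (WithLp 2 (H × H))) := by
    rw [hset]
    refine isClosed_iInter fun n => isClosed_eq ?_ ?_
    · have h1 : Continuous fun p : WithLp 2 (H × H) => p.snd :=
        (WithLp.sndL 2 ℂ H H).continuous
      fun_prop
    · have h1 : Continuous fun p : WithLp 2 (H × H) => p.fst :=
        (WithLp.fstL 2 ℂ H H).continuous
      fun_prop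
  exact hcl.completeSpace_coe

/-! ### The adjoint on `D(A)` -/

theorem norm_eq_of_coeff (A : DiagonalParabolic H) {x y : H}
    (h : ∀ n, ‖inner ℂ (A.e n) x‖ = ‖inner ℂ (A.e n) y‖) : ‖x‖ = ‖y‖ := by
  have key : ∀ z : H, ‖z‖ ^ 2 = ∑' n, ‖inner ℂ (A.e n) z‖ ^ 2 := by
    intro z
    have h1 := lp.norm_rpow_eq_tsum (p := 2) (by norm_num) (A.e.repr z)
    rw [A.e.repr.norm_map] at h1
    simpa [HilbertBasis.repr_apply_apply] using h1
  have h2 : ‖x‖ ^ 2 = ‖y‖ ^ 2 := by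
    rw [key x, key y]
    simp only [h]
  exact (sq_eq_sq₀ (norm_nonneg _) (norm_nonneg _)).1 h2

theorem exists_adjoint (A : DiagonalParabolic H) (φ : A.Dom) :
    ∃ ψ : H, (∀ n, inner ℂ (A.e n) ψ = conj (A.ev n) * inner ℂ (A.e n) (A.toH φ)) ∧
      ∀ x : A.op.domain, inner ℂ ψ (x : H) = inner ℂ (A.toH φ) (A.op x) := by
  have hmem : Memℓp (fun n => conj (A.ev n) * inner ℂ (A.e n) (A.toH φ)) (2 : ENNReal) := by
    have h1 : Memℓp (fun n => inner ℂ (A.e n) (A.toImage φ)) (2 : ENNReal) := by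
      have h0 := lp.memℓp (A.e.repr (A.toImage φ))
      have h3 : (fun n => inner ℂ (A.e n) (A.toImage φ)) = ⇑(A.e.repr (A.toImage φ)) :=
        funext fun n => (A.e.repr_apply_apply _ n).symm
      rw [h3]
      exact h0
    have h2 := memℓp_norm_iff.2 h1
    refine memℓp_norm_iff.1 ?_
    convert h2 using 2 with n
    rw [A.inner_toImage]
    simp
  have hc : ∀ n, inner ℂ (A.e n) (A.e.repr.symm ⟨_, hmem⟩) =
      conj (A.ev n) * inner ℂ (A.e n) (A.toH φ) := by
    intro n
    rw [← HilbertBasis.repr_apply_apply, LinearIsometryEquiv.apply_symm_apply]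
  refine ⟨A.e.repr.symm ⟨_, hmem⟩, hc, fun x => ?_⟩
  rw [← A.e.tsum_inner_mul_inner, ← A.e.tsum_inner_mul_inner]
  refine tsum_congr fun n => ?_
  rw [(A.mem_graph_iff _ _).1 (A.op.mem_graph x) n, ← inner_conj_symm, hc,
    ← inner_conj_symm (A.toH φ)]
  simp only [map_mul, Complex.conj_conj]
  ring

variable [CompleteSpace H]

theorem toH_mem_adjoint (A : DiagonalParabolic H) (φ : A.Dom) :
    A.toH φ ∈ A.op.adjoint.domain := by
  obtain ⟨ψ, -, h⟩ := A.exists_adjoint φ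
  exact LinearPMap.mem_adjoint_domain_of_exists _ ⟨ψ, h⟩

/-- The adjoint `A*`, restricted to `D(A)` (which is also the domain of `A*`). -/
def adj (A : DiagonalParabolic H) : A.Dom →ₗ[ℂ] H where
  toFun φ := A.op.adjoint ⟨A.toH φ, A.toH_mem_adjoint φ⟩
  map_add' φ ψ := by
    rw [← LinearPMap.map_add]
    congr 1
  map_smul' c φ := by
    rw [RingHom.id_apply, ← LinearPMap.map_smul]
    congr 1

theorem inner_adj (A : DiagonalParabolic H) (φ : A.Dom) (n : ℕ) :
    inner ℂ (A.e n) (A.adj φ) = conj (A.ev n) * inner ℂ (A.e n) (A.toH φ) := by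
  obtain ⟨ψ, hc, h⟩ := A.exists_adjoint φ
  have : A.adj φ = ψ := LinearPMap.adjoint_apply_eq A.dense_domain _ h
  rw [this, hc]

theorem norm_adj_le (A : DiagonalParabolic H) (φ : A.Dom) : ‖A.adj φ‖ ≤ ‖φ‖ := by
  have : ‖A.adj φ‖ = ‖A.toImage φ‖ := by
    refine A.norm_eq_of_coeff fun n => ?_
    rw [A.inner_adj, A.inner_toImage]
    simp
  rw [this]
  exact A.norm_toImage_le φ

theorem adj_eDom (A : DiagonalParabolic H) (n : ℕ) :
    A.adj (A.eDom n) = conj (A.ev n) • A.e n := by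
  refine A.ext_coeff fun k => ?_
  rw [A.inner_adj, A.toH_eDom, inner_smul_right]
  rcases eq_or_ne k n with rfl | hkn
  · rfl
  · rw [A.e.orthonormal.2 hkn, mul_zero, mul_zero]

/-! ### The Gelfand triple and the extension of `A` -/

/-- The map `x ↦ (φ ↦ ⟨T φ, x⟩)` from `H` to `D(A)'`, for `T : D(A) → H` bounded by one. -/
def transpose (A : DiagonalParabolic H) (T : A.Dom →ₗ[ℂ] H) (hT : ∀ φ, ‖T φ‖ ≤ ‖φ‖) :
    H →L[ℂ] A.Dual :=
  LinearMap.mkContinuous₂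
    (LinearMap.mk₂'ₛₗ (RingHom.id ℂ) (starRingEnd ℂ) (fun (x : H) (φ : A.Dom) => inner ℂ (T φ) x)
      (fun x y φ => inner_add_right _ _ _)
      (fun c x φ => inner_smul_right _ _ _)
      (fun x φ ψ => by rw [map_add, inner_add_left])
      (fun c x φ => by rw [map_smul, inner_smul_left]; rfl)) 1
    (fun x φ => by
      rw [one_mul, mul_comm]
      exact (norm_inner_le_norm _ _).trans (mul_le_mul_of_nonneg_right (hT φ) (norm_nonneg x)))

theorem transpose_apply (A : DiagonalParabolic H) (T : A.Dom →ₗ[ℂ] H)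
    (hT : ∀ φ, ‖T φ‖ ≤ ‖φ‖) (x : H) (φ : A.Dom) : A.transpose T hT x φ = inner ℂ (T φ) x := rfl

/-- The inclusion `H → D(A)'` of the Gelfand triple, `x ↦ (φ ↦ ⟨φ, x⟩)`. -/
def incl (A : DiagonalParabolic H) : H →L[ℂ] A.Dual := A.transpose A.toH A.norm_toH_le

/-- The extension of `A` to a bounded operator `H → D(A)'`, `x ↦ (φ ↦ ⟨A* φ, x⟩)`. -/
def opExt (A : DiagonalParabolic H) : H →L[ℂ] A.Dual := A.transpose A.adj A.norm_adj_le

theorem incl_coeff (A : DiagonalParabolic H) (x : H) (n : ℕ) :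
    A.incl x (A.eDom n) = inner ℂ (A.e n) x := rfl

theorem opExt_coeff (A : DiagonalParabolic H) (x : H) (n : ℕ) :
    A.opExt x (A.eDom n) = A.ev n * inner ℂ (A.e n) x := by
  change inner ℂ (A.adj (A.eDom n)) x = _
  rw [A.adj_eDom, inner_smul_left, Complex.conj_conj]

/-- On `D(A)` the extension is `A` itself. -/
theorem opExt_toH (A : DiagonalParabolic H) (φ : A.Dom) : A.opExt (A.toH φ) = A.incl (A.toImage φ) := by
  ext ψ
  change inner ℂ (A.adj ψ) (A.toH φ) = inner ℂ (A.toH ψ) (A.toImage φ)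
  rw [A.toImage_eq]
  exact LinearPMap.adjoint_isFormalAdjoint A.dense_domain ⟨A.toH ψ, A.toH_mem_adjoint ψ⟩
    ⟨A.toH φ, A.toH_mem φ⟩

/-! ### Low and high frequencies -/

theorem finite_low (A : DiagonalParabolic H) (lam : ℝ) : {n | -lam ≤ (A.ev n).re}.Finite := by
  have h := A.tendsto_re.eventually_lt_atBot (-lam)
  rw [← Nat.cofinite_eq_atTop, Filter.eventually_cofinite] at h
  simpa using h

/-- The finitely many indices `n` with `Re (ev n) ≥ -lam`. -/
def low (A : DiagonalParabolic H) (lam : ℝ) : Finset ℕ := (A.finite_low lam).toFinset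

theorem mem_low (A : DiagonalParabolic H) {lam : ℝ} {n : ℕ} :
    n ∈ A.low lam ↔ -lam ≤ (A.ev n).re := by
  simp [low]

/-- The eigenspace `ker (A - μ)`. -/
def eigenspace (A : DiagonalParabolic H) (μ : ℂ) : Submodule ℂ H :=
  A.op.graph.comap (LinearMap.prod LinearMap.id (μ • LinearMap.id))

/-- `m(lam)`: the greatest multiplicity of an eigenvalue `ev n` with `Re (ev n) ≥ -lam`. -/
def maxMult (A : DiagonalParabolic H) (lam : ℝ) : ℕ :=
  (A.low lam).sup fun n => Module.finrank ℂ (A.eigenspace (A.ev n))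

/-- The closed span in `H` of the `e n` with `Re (ev n) < -lam`. -/
def highH (A : DiagonalParabolic H) (lam : ℝ) : Submodule ℂ H :=
  (Submodule.span ℂ (A.e '' {n | (A.ev n).re < -lam})).topologicalClosure

/-- The closed span in `D(A)'` of the `e n` with `Re (ev n) < -lam`. -/
def highDual (A : DiagonalParabolic H) (lam : ℝ) : Submodule ℂ A.Dual :=
  (Submodule.span ℂ ((fun n => A.incl (A.e n)) '' {n | (A.ev n).re < -lam})).topologicalClosure

theorem inner_eq_zero_of_mem_highH (A : DiagonalParabolic H) {lam : ℝ} {x : H}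
    (hx : x ∈ A.highH lam) {n : ℕ} (hn : -lam ≤ (A.ev n).re) : inner ℂ (A.e n) x = 0 := by
  have hle : A.highH lam ≤ LinearMap.ker (innerSL ℂ (A.e n)).toLinearMap := by
    refine Submodule.topologicalClosure_minimal _ (Submodule.span_le.2 ?_)
      (innerSL ℂ (A.e n)).isClosed_ker
    rintro _ ⟨k, hk, rfl⟩
    have hkn : n ≠ k := by
      rintro rfl
      exact absurd hn (not_le.2 hk)
    exact A.e.orthonormal.2 hkn
  exact hle hx

theorem inner_eDom (A : DiagonalParabolic H) (φ : A.Dom) (n : ℕ) :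
    inner ℂ (A.eDom n) φ = (1 + conj (A.ev n) * A.ev n) * inner ℂ (A.e n) (A.toH φ) := by
  rw [A.inner_dom, A.toH_eDom, A.toImage_eDom, inner_smul_left, A.inner_toImage]
  ring

theorem weight_ne_zero (A : DiagonalParabolic H) (n : ℕ) : 1 + conj (A.ev n) * A.ev n ≠ 0 := by
  rw [← Complex.normSq_eq_conj_mul_self]
  exact_mod_cast (by linarith [Complex.normSq_nonneg (A.ev n)] : (0 : ℝ) <
    1 + Complex.normSq (A.ev n)).ne'

/-- A functional without low-frequency coefficients is a limit of high-frequency ones. -/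
theorem mem_highDual (A : DiagonalParabolic H) {lam : ℝ} {f : A.Dual}
    (hf : ∀ n, -lam ≤ (A.ev n).re → f (A.eDom n) = 0) : f ∈ A.highDual lam := by
  obtain ⟨g, rfl⟩ : ∃ g : A.Dom, innerSLFlip ℂ g = f := by
    let f' : StrongDual ℂ A.Dom :=
      { toFun := fun φ => conj (f φ)
        map_add' := fun φ ψ => by simp
        map_smul' := fun c φ => by simp
        cont := Complex.continuous_conj.comp f.continuous }
    refine ⟨(InnerProductSpace.toDual ℂ A.Dom).symm f', ?_⟩
    ext φ
    rw [innerSLFlip_apply_apply, ← inner_conj_symm, InnerProductSpace.toDual_symm_apply]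
    exact Complex.conj_conj _
  have hg : ∀ n, -lam ≤ (A.ev n).re → inner ℂ (A.e n) (A.toH g) = 0 := by
    intro n hn
    have h := hf n hn
    rw [innerSLFlip_apply_apply, A.inner_eDom] at h
    exact (mul_eq_zero.1 h).resolve_left (A.weight_ne_zero n)
  have hR : ∀ n, innerSLFlip ℂ (A.eDom n) = (1 + conj (A.ev n) * A.ev n) • A.incl (A.e n) := by
    intro n
    ext φ
    rw [innerSLFlip_apply_apply, ← inner_conj_symm, A.inner_eDom, map_mul, inner_conj_symm]
    change _ = (1 + conj (A.ev n) * A.ev n) * inner ℂ (A.toH φ) (A.e n)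
    simp only [map_add, map_mul, map_one, Complex.conj_conj]
    ring
  set V : Submodule ℂ A.Dom := Submodule.span ℂ (A.eDom '' {n | (A.ev n).re < -lam}) with hV
  have hgV : g ∈ V.topologicalClosure := by
    rw [← Submodule.orthogonal_orthogonal_eq_closure, Submodule.mem_orthogonal]
    intro x hx
    have hx' : ∀ n, (A.ev n).re < -lam → inner ℂ (A.e n) (A.toH x) = 0 := by
      intro n hn
      have h := (Submodule.mem_orthogonal _ _).1 hx (A.eDom n) (Submodule.subset_span ⟨n, hn, rfl⟩)
      rw [A.inner_eDom] at h
      exact (mul_eq_zero.1 h).resolve_left (A.weight_ne_zero n)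
    have hz : ∀ n, inner ℂ (A.e n) (A.toH x) = 0 ∨ inner ℂ (A.e n) (A.toH g) = 0 := by
      intro n
      rcases lt_or_ge (A.ev n).re (-lam) with h | h
      · exact Or.inl (hx' n h)
      · exact Or.inr (hg n h)
    rw [A.inner_dom, ← A.e.tsum_inner_mul_inner, ← A.e.tsum_inner_mul_inner]
    have h1 : ∀ n, inner ℂ (A.toH x) (A.e n) * inner ℂ (A.e n) (A.toH g) = 0 := by
      intro n
      rcases hz n with h | h
      · rw [← inner_conj_symm, h, map_zero, zero_mul]
      · rw [h, mul_zero]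
    have h2 : ∀ n, inner ℂ (A.toImage x) (A.e n) * inner ℂ (A.e n) (A.toImage g) = 0 := by
      intro n
      rcases hz n with h | h
      · rw [← inner_conj_symm, A.inner_toImage, h, mul_zero, map_zero, zero_mul]
      · rw [A.inner_toImage, h, mul_zero, mul_zero]
    simp only [h1, h2, tsum_zero, add_zero]
  have hle : V.topologicalClosure ≤
      (A.highDual lam).comap (innerSLFlip ℂ : A.Dom →L[ℂ] A.Dual).toLinearMap := by
    refine Submodule.topologicalClosure_minimal _ (Submodule.span_le.2 ?_) ?_
    · rintro _ ⟨n, hn, rfl⟩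
      change innerSLFlip ℂ (A.eDom n) ∈ A.highDual lam
      rw [hR]
      exact Submodule.smul_mem _ _
        (Submodule.le_topologicalClosure _ (Submodule.subset_span ⟨n, hn, rfl⟩))
    · exact (Submodule.isClosed_topologicalClosure _).preimage
        (innerSLFlip ℂ : A.Dom →L[ℂ] A.Dual).continuous
  exact hle hgV

/-- The inclusion `H_lam → D(A)'_lam` of the high-frequency spaces. -/
def inclHigh (A : DiagonalParabolic H) (lam : ℝ) : A.highH lam →L[ℂ] A.highDual lam :=
  (A.incl ∘L (A.highH lam).subtypeL).codRestrict (A.highDual lam) fun x =>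
    A.mem_highDual fun _ hn => A.inner_eq_zero_of_mem_highH x.2 hn

/-- The high-frequency part `A_H : H_lam → D(A)'_lam` of `A`. -/
def opHigh (A : DiagonalParabolic H) (lam : ℝ) : A.highH lam →L[ℂ] A.highDual lam :=
  (A.opExt ∘L (A.highH lam).subtypeL).codRestrict (A.highDual lam) fun x =>
    A.mem_highDual fun n hn => by
      change A.opExt (x : H) (A.eDom n) = 0
      rw [A.opExt_coeff, A.inner_eq_zero_of_mem_highH x.2 hn, mul_zero]

/-- The low-frequency part `P_L f = ∑ f(e n) e n`, over `Re (ev n) ≥ -lam`, of `f` in `D(A)'`. -/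
def lowPart (A : DiagonalParabolic H) (lam : ℝ) (f : A.Dual) : A.Dual :=
  ∑ n ∈ A.low lam, f (A.eDom n) • A.incl (A.e n)

/-- The high-frequency part `P_H f = f - P_L f`, an element of `D(A)'_lam`: the component of `f`
along `D(A)'_lam` in the orthogonal decomposition of `D(A)'`. -/
def highPart (A : DiagonalParabolic H) (lam : ℝ) (f : A.Dual) : A.highDual lam :=
  ⟨f - A.lowPart lam f, A.mem_highDual fun n hn => by
    have hsum : A.lowPart lam f (A.eDom n) =
        ∑ k ∈ A.low lam, f (A.eDom k) * inner ℂ (A.e n) (A.e k) := by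
      simp only [lowPart, sum_apply, smul_apply,
        A.incl_coeff, smul_eq_mul]
    rw [sub_apply, hsum,
      Finset.sum_eq_single_of_mem n (A.mem_low.2 hn) fun k _ hk => by
        rw [A.e.orthonormal.2 hk.symm, mul_zero],
      inner_self_eq_norm_sq_to_K, A.e.orthonormal.1 n]
    simp⟩

/-! ### The commutant of `A_H` and the space `N_{B_H}` -/

/-- `C(A_H)`: the bounded operators `M` on `D(A)'_lam` which restrict to a bounded operator `R` on
`H_lam` and satisfy `A_H M = M A_H` as operators from `H_lam` to `D(A)'_lam`. -/
def commutant (A : DiagonalParabolic H) (lam : ℝ) : Set (A.highDual lam →L[ℂ] A.highDual lam) :=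
  {M | ∃ R : A.highH lam →L[ℂ] A.highH lam,
    (∀ x, M (A.inclHigh lam x) = A.inclHigh lam (R x)) ∧
    ∀ x, A.opHigh lam (R x) = M (A.opHigh lam x)}

/-- `N_{B_H}`: the operators in `C(A_H)` which annihilate the high-frequency part of `B`. -/
def annihilator (A : DiagonalParabolic H) (lam : ℝ) {m : ℕ} (B : Fin m → A.Dual) :
    Set (A.highDual lam →L[ℂ] A.highDual lam) :=
  {M | M ∈ A.commutant lam ∧ ∀ j, M (A.highPart lam (B j)) = 0}

/-! ### Frequency decompositions and admissible control operators -/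

/-- A partition of the eigenbasis into `m(lam)` sequences, `k ↦ e (σ (j, k))` being the `j`-th one,
such that the first `N j ≥ 1` members of the sequences together are the `e n` with
`Re (ev n) ≥ -lam`, and such that the eigenvalues of these first members are pairwise distinct
within each sequence. -/
structure FreqDecomposition (A : DiagonalParabolic H) (lam : ℝ) where
  σ : Fin (A.maxMult lam) × ℕ ≃ ℕ
  N : Fin (A.maxMult lam) → ℕ
  N_pos : ∀ j, 0 < N j
  low_iff : ∀ j k, k < N j ↔ -lam ≤ (A.ev (σ (j, k))).re
  simple : ∀ j k l, k < N j → l < N j → A.ev (σ (j, k)) = A.ev (σ (j, l)) → k = l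

/-- `F_lam`-admissibility of `B` with respect to the decomposition `P`: each `B j` lies in the
summand `D(A_j)'` of `D(A)'`, i.e. it vanishes on the elements of `D(A)` orthogonal to the `j`-th
sequence, and it does not vanish on the low-frequency members of the `j`-th sequence. -/
def IsFAdmissible {A : DiagonalParabolic H} {lam : ℝ} (P : A.FreqDecomposition lam)
    (B : Fin (A.maxMult lam) → A.Dual) : Prop :=
  ∀ j, (∀ φ : A.Dom, (∀ k, inner ℂ (A.e (P.σ (j, k))) (A.toH φ) = 0) → B j φ = 0) ∧
    ∀ k < P.N j, B j (A.eDom (P.σ (j, k))) ≠ 0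

/-! ### Approximate controllability -/

/-- `u` is the solution on `[0, τ]` of `u' = A u + B w`, `u(0) = u₀`: it is continuous with values
in `D(A)'`, and for all `φ` in `D(A)` such that `A* φ` is again an element `ψ` of `D(A)`,
`⟨u(t), φ⟩ = ⟨u₀, φ⟩ + ∫₀ᵗ (⟨u(s), A* φ⟩ + ⟨B w(s), φ⟩) ds` for all `t` in `[0, τ]`. -/
def IsSolution (A : DiagonalParabolic H) {m : ℕ} (B : Fin m → A.Dual) (τ : ℝ) (u₀ : H)
    (w : ℝ → EuclideanSpace ℂ (Fin m)) (u : ℝ → A.Dual) : Prop :=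
  ContinuousOn u (Set.Icc 0 τ) ∧
    ∀ φ ψ : A.Dom, A.toH ψ = A.adj φ → ∀ t ∈ Set.Icc 0 τ,
      u t φ = A.incl u₀ φ + ∫ s in (0 : ℝ)..t, (u s ψ + (∑ j, w s j • B j) φ)

/-- Approximate controllability in time `τ`: every `u₀` in `H` can be steered, by a control in
`L²(0, τ; ℂᵐ)`, to a state `u(τ)` that lies in `H`, at `H`-distance at most `ε` from a given `u₁` in
`H`. -/
def IsApproxControllable (A : DiagonalParabolic H) {m : ℕ} (B : Fin m → A.Dual) (τ : ℝ) : Prop :=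
  ∀ u₀ u₁ : H, ∀ ε : ℝ, 0 < ε →
    ∃ w : ℝ → EuclideanSpace ℂ (Fin m),
      MeasureTheory.MemLp w 2 (MeasureTheory.volume.restrict (Set.Ioo 0 τ)) ∧
      ∃ u : ℝ → A.Dual, A.IsSolution B τ u₀ w u ∧ ∃ y : H, u τ = A.incl y ∧ ‖y - u₁‖ ≤ ε

end DiagonalParabolic

end

/-!
Both conditions are equivalent to the Fattorini–Hautus test `DiagonalParabolic.FattoriniHautus`:
no eigenvector of `A*` is annihilated by all the `B j`.

*The commutant.* An operator `M` of `C(A_H)` preserves the eigenspaces of `A_H`. Since these are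
finite-dimensional, each functional `f ↦ (M f)(e k)` is the evaluation at an eigenvector of `A*`. If
`M` kills the high-frequency part of every `B j`, the test makes all these eigenvectors vanish, so
`M = 0`. Conversely a high-frequency eigenvector `v` annihilated by `B` yields the rank-one operator
`f ↦ f(v) e_n` of `N_{B_H}`, where `e_n` belongs to the same eigenvalue. Low-frequency eigenvectors
pass the test by `F_lam`-admissibility alone.

*Controllability implies the test.* If `v` is an eigenvector of `A*` annihilated by `B`, the
component `⟨u(t), v⟩` of a solution from `0` solves `y' = μ y`, `y(0) = 0`, so that `v` itself cannot
be approximated.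

*The test implies controllability.* The sector condition makes the orbits `exp(t A) B_j` continuous
in `H` for `t > 0`. Controls that vanish near the final time therefore lead from `0` to states of
`H`, by Duhamel's formula (`exists_forced_solution`), and a vector `z` orthogonal to all of them
satisfies `∑ n, ⟨z, e n⟩ B_j(e n) exp(ev n * t) = 0` on `(0, τ)`. By analytic continuation to a
neighbourhood of the half-line this holds for all `t > 0`; dividing by the leading exponential and
taking the mean value over `t`, one sees that the coefficients at the leading eigenvalue sum to zero
(`tsum_leading_eq_zero`). This says that the component of `z` along the leading eigenspace is an
eigenvector of `A*` annihilated by every `B_j`; by the test it is zero. So `z = 0`, the reachable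
states are dense in `H`, and superposition with the free solution, which stays in `H`, gives
approximate controllability.
-/

namespace DiagonalParabolic

open Filter Topology

variable {H : Type*} [NormedAddCommGroup H] [InnerProductSpace ℂ H]

/-! ### Coefficients in the eigenbasis -/

theorem hasSum_eDom (A : DiagonalParabolic H) (φ : A.Dom) :
    HasSum (fun n => inner ℂ (A.e n) (A.toH φ) • A.eDom n) φ := by
  have h1 : HasSum (fun n => inner ℂ (A.e n) (A.toH φ) • A.e n) (A.toH φ) := by
    simpa [HilbertBasis.repr_apply_apply] using A.e.hasSum_repr (A.toH φ)
  have h2 : HasSum (fun n => inner ℂ (A.e n) (A.toH φ) • A.ev n • A.e n) (A.toImage φ) := by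
    have h := A.e.hasSum_repr (A.toImage φ)
    refine h.congr_fun ?_
    intro n
    rw [HilbertBasis.repr_apply_apply, A.inner_toImage, smul_smul, mul_comm]
  have h3 := (h1.prodMk h2).mapL
    (WithLp.prodContinuousLinearEquiv 2 ℂ H H).symm.toContinuousLinearMap
  have hind : Topology.IsInducing A.domSubmodule.subtype := Topology.IsInducing.subtypeVal
  exact (hind.hasSum_iff (fun n => inner ℂ (A.e n) (A.toH φ) • A.eDom n) φ).1 h3

theorem ext_dom (A : DiagonalParabolic H) {φ ψ : A.Dom}
    (h : ∀ n, inner ℂ (A.e n) (A.toH φ) = inner ℂ (A.e n) (A.toH ψ)) : φ = ψ := by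
  have h1 := A.hasSum_eDom φ
  simp only [h] at h1
  exact h1.unique (A.hasSum_eDom ψ)

theorem hasSum_dual (A : DiagonalParabolic H) (f : A.Dual) (φ : A.Dom) :
    HasSum (fun n => conj (inner ℂ (A.e n) (A.toH φ)) * f (A.eDom n)) (f φ) := by
  have h := (A.hasSum_eDom φ).map f f.continuous
  refine h.congr_fun ?_
  intro n
  simp

theorem ext_dual (A : DiagonalParabolic H) {f g : A.Dual}
    (h : ∀ n, f (A.eDom n) = g (A.eDom n)) : f = g := by
  ext φ
  have h1 := A.hasSum_dual f φ
  simp only [h] at h1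
  exact h1.unique (A.hasSum_dual g φ)

theorem inner_e_e (A : DiagonalParabolic H) (n k : ℕ) :
    inner ℂ (A.e n) (A.e k) = if n = k then 1 else 0 :=
  orthonormal_iff_ite.1 A.e.orthonormal n k

theorem hasSum_norm_sq (A : DiagonalParabolic H) (x : H) :
    HasSum (fun n => ‖inner ℂ (A.e n) x‖ ^ 2) (‖x‖ ^ 2) := by
  have h := lp.hasSum_norm (p := 2) (by norm_num) (A.e.repr x)
  rw [A.e.repr.norm_map] at h
  simpa [HilbertBasis.repr_apply_apply] using h

theorem exists_coeff (A : DiagonalParabolic H) {c : ℕ → ℂ} (hc : Summable fun n => ‖c n‖ ^ 2) :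
    ∃ x : H, ∀ n, inner ℂ (A.e n) x = c n := by
  have hmem : Memℓp c (2 : ENNReal) := by
    refine memℓp_gen ?_
    simpa using hc
  refine ⟨A.e.repr.symm ⟨c, hmem⟩, fun n => ?_⟩
  rw [← HilbertBasis.repr_apply_apply, LinearIsometryEquiv.apply_symm_apply]

/-- Dominated convergence for the coefficients in the eigenbasis. -/
theorem continuousOn_of_coeff (A : DiagonalParabolic H) {X : Type*} [TopologicalSpace X] {s : Set X}
    {f : X → H} {b : ℕ → ℝ} (hb : Summable fun n => b n ^ 2)
    (hc : ∀ n, ContinuousOn (fun x => inner ℂ (A.e n) (f x)) s)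
    (hfb : ∀ n, ∀ x ∈ s, ‖inner ℂ (A.e n) (f x)‖ ≤ b n) : ContinuousOn f s := by
  intro x₀ hx₀
  change Tendsto f (𝓝[s] x₀) (𝓝 (f x₀))
  have h1 : Tendsto (fun x => ∑' n, ‖inner ℂ (A.e n) (f x - f x₀)‖ ^ 2) (𝓝[s] x₀)
      (𝓝 (∑' _ : ℕ, (0 : ℝ))) := by
    refine tendsto_tsum_of_dominated_convergence (bound := fun n => 4 * b n ^ 2)
      (hb.mul_left 4) (fun n => ?_) ?_
    · have h2 : Tendsto (fun x => inner ℂ (A.e n) (f x)) (𝓝[s] x₀)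
          (𝓝 (inner ℂ (A.e n) (f x₀))) := hc n x₀ hx₀
      have h3 := ((h2.sub_const (inner ℂ (A.e n) (f x₀))).norm).pow 2
      simpa [inner_sub_right] using h3
    · filter_upwards [self_mem_nhdsWithin] with x hx n
      rw [Real.norm_of_nonneg (by positivity), inner_sub_right]
      have h4 := norm_sub_le (inner ℂ (A.e n) (f x)) (inner ℂ (A.e n) (f x₀))
      have h5 := hfb n x hx
      have h6 := hfb n x₀ hx₀
      calc _ ≤ (2 * b n) ^ 2 := pow_le_pow_left₀ (norm_nonneg _) (by linarith) 2
        _ = _ := by ring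
  rw [tendsto_iff_norm_sub_tendsto_zero]
  have h7 := h1.sqrt
  simp only [(A.hasSum_norm_sq _).tsum_eq, Real.sqrt_sq (norm_nonneg _), tsum_zero,
    Real.sqrt_zero] at h7
  exact h7

/-! ### The diagonal semigroup -/

theorem norm_exp_ev_le (A : DiagonalParabolic H) (n : ℕ) {t T : ℝ} (ht : t ∈ Set.Icc 0 T) :
    ‖Complex.exp (A.ev n * t)‖ ≤ Real.exp (|(A.ev 0).re| * T) := by
  rw [Complex.norm_exp, Real.exp_le_exp]
  have h1 : (A.ev n).re ≤ |(A.ev 0).re| := (A.antitone_re (Nat.zero_le n)).trans (le_abs_self _)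
  have h2 := abs_nonneg (A.ev 0).re
  simp only [Complex.mul_re, Complex.ofReal_re, Complex.ofReal_im, mul_zero, sub_zero]
  nlinarith [ht.1, ht.2, mul_le_mul_of_nonneg_right h1 ht.1, mul_le_mul_of_nonneg_left ht.2 h2]

/-- The sector condition makes `μ ↦ μ exp(μ t)` bounded on the spectrum, away from `t = 0`. -/
theorem exists_norm_ev_mul_exp_le (A : DiagonalParabolic H) {δ T : ℝ} (hδ : 0 < δ) :
    ∃ K : ℝ, ∀ n, ∀ t ∈ Set.Icc δ T, (1 + ‖A.ev n‖) * ‖Complex.exp (A.ev n * t)‖ ≤ K := by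
  obtain ⟨C, hC, hsec⟩ := A.sector
  set r := |(A.ev 0).re| with hr
  have hr0 : 0 ≤ r := abs_nonneg _
  refine ⟨(1 + (1 + 1 / C) * (r + 1 / δ)) * Real.exp (r * T), fun n t ht => ?_⟩
  have h1 : (A.ev n).re ≤ r := (A.antitone_re (Nat.zero_le n)).trans (le_abs_self _)
  set s := (A.ev n).re with hs
  have h2 : ‖A.ev n‖ ≤ (1 + 1 / C) * |s| := by
    have h3 := Complex.norm_le_abs_re_add_abs_im (A.ev n)
    have h4 : |(A.ev n).im| ≤ |s| / C := by
      rw [le_div_iff₀ hC, mul_comm]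
      exact hsec n
    calc _ ≤ _ := h3
      _ ≤ |s| + |s| / C := by gcongr
      _ = _ := by ring
  have h5 : |s| ≤ r + (r - s) := by
    rw [abs_le]
    constructor <;> linarith
  have h6 : ‖Complex.exp (A.ev n * t)‖ ≤ Real.exp (-((r - s) * δ)) * Real.exp (r * T) := by
    rw [Complex.norm_exp, ← Real.exp_add, Real.exp_le_exp]
    simp only [Complex.mul_re, Complex.ofReal_re, Complex.ofReal_im, mul_zero, sub_zero]
    nlinarith [mul_nonneg (sub_nonneg.2 h1) (sub_nonneg.2 ht.1),
      mul_nonneg hr0 (sub_nonneg.2 ht.2)]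
  have h7 : (r - s) * Real.exp (-((r - s) * δ)) ≤ 1 / δ := by
    rw [Real.exp_neg, ← div_eq_mul_inv, div_le_div_iff₀ (Real.exp_pos _) hδ, one_mul]
    linarith [Real.add_one_le_exp ((r - s) * δ)]
  have h8 : Real.exp (-((r - s) * δ)) ≤ 1 := by
    rw [Real.exp_le_one_iff]
    nlinarith
  have hE := Real.exp_pos (-((r - s) * δ))
  have hC' : 0 ≤ 1 + 1 / C := by positivity
  calc _ ≤ (1 + (1 + 1 / C) * (r + (r - s))) *
        (Real.exp (-((r - s) * δ)) * Real.exp (r * T)) := by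
        gcongr
        exact h2.trans (by gcongr)
    _ = (Real.exp (-((r - s) * δ)) + (1 + 1 / C) * (r * Real.exp (-((r - s) * δ)) +
        (r - s) * Real.exp (-((r - s) * δ)))) * Real.exp (r * T) := by ring
    _ ≤ (1 + (1 + 1 / C) * (r * 1 + 1 / δ)) * Real.exp (r * T) := by gcongr
    _ = _ := by ring

/-- The orbit `t ↦ exp(t A) x` on `[0, T]` is continuous in `H`. -/
theorem exists_orbit (A : DiagonalParabolic H) (T : ℝ) (x : H) :
    ∃ S : ℝ → H, ContinuousOn S (Set.Icc 0 T) ∧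
      ∀ t ∈ Set.Icc 0 T, ∀ n, inner ℂ (A.e n) (S t) =
        Complex.exp (A.ev n * t) * inner ℂ (A.e n) x := by
  set K := Real.exp (|(A.ev 0).re| * T)
  have hb : ∀ t ∈ Set.Icc 0 T, ∀ n, ‖Complex.exp (A.ev n * t) * inner ℂ (A.e n) x‖ ≤
      K * ‖inner ℂ (A.e n) x‖ := by
    intro t ht n
    rw [norm_mul]
    gcongr
    exact A.norm_exp_ev_le n ht
  have hs : Summable fun n => (K * ‖inner ℂ (A.e n) x‖) ^ 2 := by
    simp only [mul_pow]
    exact (A.hasSum_norm_sq x).summable.mul_left _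
  have hex : ∀ t ∈ Set.Icc 0 T, ∃ y : H, ∀ n, inner ℂ (A.e n) y =
      Complex.exp (A.ev n * t) * inner ℂ (A.e n) x := fun t ht =>
    A.exists_coeff (Summable.of_nonneg_of_le (fun _ => by positivity)
      (fun n => pow_le_pow_left₀ (norm_nonneg _) (hb t ht n) 2) hs)
  choose! S hS using hex
  refine ⟨S, A.continuousOn_of_coeff hs (fun n => ?_) fun n t ht => ?_, hS⟩
  · refine ContinuousOn.congr (f := fun t : ℝ => Complex.exp (A.ev n * t) * inner ℂ (A.e n) x)
      (Continuous.continuousOn (by fun_prop)) fun t ht => hS t ht n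
  · rw [hS t ht]
    exact hb t ht n


/-! ### Uniqueness for the exponential series of the spectrum -/

/-- An exponential series over the spectrum that converges absolutely for `t > 0` extends
holomorphically to a neighbourhood of the half-line, so that it vanishes for all `t > 0` if it
vanishes on some interval `(0, τ)`. -/
theorem tsum_exp_eq_zero_of_eq_zero_on_Ioo (A : DiagonalParabolic H) {a : ℕ → ℂ} {τ : ℝ}
    (hτ : 0 < τ) (hs : ∀ t : ℝ, 0 < t → Summable fun n => a n * Complex.exp (A.ev n * t))
    (h0 : ∀ t ∈ Set.Ioo 0 τ, ∑' n, a n * Complex.exp (A.ev n * (t : ℝ)) = 0) {t : ℝ} (ht : 0 < t) :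
    ∑' n, a n * Complex.exp (A.ev n * t) = 0 := by
  obtain ⟨C, hC, hsec⟩ := A.sector
  set δ := min t τ / 2 with hδdef
  have hmin : 0 < min t τ := lt_min ht hτ
  have hδ : 0 < δ := by positivity
  have hδt : δ < t := by linarith [min_le_left t τ]
  have hδτ : δ < τ := by linarith [min_le_right t τ]
  set T := t + τ + 1 with hT
  set r := |(A.ev 0).re| with hr
  have hr0 : 0 ≤ r := abs_nonneg _
  -- The height of the box is chosen by the sector condition: there `Re (ev n * z)` stays below
  -- `Re (ev n) * δ / 2` up to a constant.
  set U : Set ℂ := Set.Ioo δ T ×ℂ Set.Ioo (-(C * δ / 2)) (C * δ / 2) with hU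
  have hη : 0 < C * δ / 2 := by positivity
  have hUo : IsOpen U := isOpen_Ioo.reProdIm isOpen_Ioo
  have hUc : IsPreconnected U :=
    (((convex_Ioo δ T).linear_preimage Complex.reLm).inter
      ((convex_Ioo (-(C * δ / 2)) (C * δ / 2)).linear_preimage Complex.imLm)).isPreconnected
  have hbound : ∀ n, ∀ z ∈ U, ‖a n * Complex.exp (A.ev n * z)‖ ≤
      Real.exp (r * T) * ‖a n * Complex.exp (A.ev n * (δ / 2 : ℝ))‖ := by
    rintro n z ⟨⟨hz1, hz2⟩, hz3, hz4⟩
    have h1 : (A.ev n).re ≤ r := (A.antitone_re (Nat.zero_le n)).trans (le_abs_self _)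
    have h2 := hsec n
    set s := (A.ev n).re with hs
    have h5 : |s| ≤ r + (r - s) := by
      rw [abs_le]
      constructor <;> linarith
    have h6 : |(A.ev n).im * z.im| ≤ (r + (r - s)) * (δ / 2) := by
      rw [abs_mul]
      calc |(A.ev n).im| * |z.im| ≤ |(A.ev n).im| * (C * δ / 2) := by
            gcongr
            exact (abs_lt.2 ⟨hz3, hz4⟩).le
        _ = C * |(A.ev n).im| * (δ / 2) := by ring
        _ ≤ |s| * (δ / 2) := by gcongr
        _ ≤ _ := by gcongr
    rw [norm_mul, norm_mul, mul_left_comm, Complex.norm_exp, Complex.norm_exp, ← Real.exp_add]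
    gcongr
    rw [Complex.mul_re, Complex.re_mul_ofReal]
    have h7 := neg_le_of_abs_le h6
    have hzT : r * z.re ≤ r * (T - δ / 2) + r * (δ / 2) := by
      rw [← mul_add]
      gcongr
      linarith
    nlinarith [mul_nonneg (sub_nonneg.2 h1) (sub_nonneg.2 hz1.le)]
  have hsu : Summable fun n =>
      Real.exp (r * T) * ‖a n * Complex.exp (A.ev n * (δ / 2 : ℝ))‖ :=
    (hs (δ / 2) (by positivity)).norm.mul_left _
  have hdiff : DifferentiableOn ℂ (fun z => ∑' n, a n * Complex.exp (A.ev n * z)) U :=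
    Complex.differentiableOn_tsum_of_summable_norm hsu
      (fun n => Differentiable.differentiableOn (by fun_prop)) hUo hbound
  have hmem : ∀ x : ℝ, δ < x → x < T → (x : ℂ) ∈ U := fun x h1 h2 =>
    ⟨⟨by simpa using h1, by simpa using h2⟩, by simpa using hη, by simpa using hη⟩
  have hx₀ : (δ + τ) / 2 ∈ Set.Ioo δ τ := ⟨by linarith, by linarith⟩
  refine (hdiff.analyticOnNhd hUo).eqOn_zero_of_preconnected_of_frequently_eq_zero hUc
    (hmem ((δ + τ) / 2) hx₀.1 (by linarith [hx₀.2])) ?_ (hmem t hδt (by linarith))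
  have htend : Tendsto ((↑) : ℝ → ℂ) (𝓝[≠] ((δ + τ) / 2)) (𝓝[≠] (((δ + τ) / 2 : ℝ) : ℂ)) :=
    Complex.continuous_ofReal.continuousWithinAt.tendsto_nhdsWithin fun x hx =>
      Complex.ofReal_injective.ne hx
  refine htend.frequently (Eventually.frequently ?_)
  filter_upwards [nhdsWithin_le_nhds (Ioo_mem_nhds hx₀.1 hx₀.2)] with x hx
  exact h0 x ⟨hδ.trans hx.1, hx.2⟩

/-- The mean value of `s ↦ exp(ν s)` over a half-line, for `Re ν ≤ 0`, is one or zero according to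
whether `ν = 0`. -/
theorem tendsto_mean_exp {ν : ℂ} (hν : ν.re ≤ 0) :
    Tendsto (fun T : ℝ => (T : ℂ)⁻¹ * ∫ s in (1 : ℝ)..T, Complex.exp (ν * s)) atTop
      (𝓝 (if ν = 0 then 1 else 0)) := by
  split_ifs with h
  · subst h
    have h1 : Tendsto (fun T : ℝ => (1 : ℂ) - ((T⁻¹ : ℝ) : ℂ)) atTop (𝓝 (1 - ((0 : ℝ) : ℂ))) :=
      ((Complex.continuous_ofReal.tendsto 0).comp tendsto_inv_atTop_zero).const_sub 1
    rw [Complex.ofReal_zero, sub_zero] at h1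
    refine h1.congr' ?_
    filter_upwards [eventually_gt_atTop 0] with T hT
    have : (T : ℂ) ≠ 0 := by exact_mod_cast hT.ne'
    simp
    field_simp
  · have h1 : Tendsto (fun T : ℝ => T⁻¹ * (2 / ‖ν‖)) atTop (𝓝 (0 * (2 / ‖ν‖))) :=
      tendsto_inv_atTop_zero.mul_const _
    rw [zero_mul] at h1
    refine squeeze_zero_norm' ?_ h1
    filter_upwards [eventually_gt_atTop 0] with T hT
    have h2 : ∀ s : ℝ, 0 ≤ s → ‖Complex.exp (ν * s)‖ ≤ 1 := by
      intro s hs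
      rw [Complex.norm_exp, Complex.re_mul_ofReal, Real.exp_le_one_iff]
      exact mul_nonpos_of_nonpos_of_nonneg hν hs
    rw [integral_exp_mul_complex h, norm_mul, norm_inv, Complex.norm_real,
      Real.norm_of_nonneg hT.le, norm_div]
    gcongr
    exact (norm_sub_le _ _).trans (by linarith [h2 T hT.le, h2 1 zero_le_one])

/-- If an exponential series over the spectrum vanishes on `(0, τ)`, then the coefficients at its
leading eigenvalue sum to zero: this sum is the mean value of the series after division by the
leading exponential. -/
theorem tsum_leading_eq_zero (A : DiagonalParabolic H) {a : ℕ → ℂ} {τ : ℝ}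
    (hτ : 0 < τ) (hs : ∀ t : ℝ, 0 < t → Summable fun n => a n * Complex.exp (A.ev n * t))
    (h0 : ∀ t ∈ Set.Ioo 0 τ, ∑' n, a n * Complex.exp (A.ev n * (t : ℝ)) = 0) {k : ℕ}
    (hk : ∀ n < k, a n = 0) : ∑' n, (if A.ev n = A.ev k then a n else 0) = 0 := by
  set f : ℕ → ℝ → ℂ := fun n t => a n * Complex.exp ((A.ev n - A.ev k) * t) with hf
  have hfeq : ∀ n t, f n t = a n * Complex.exp (A.ev n * t) * Complex.exp (-(A.ev k * t)) := by
    intro n t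
    rw [hf, mul_assoc, ← Complex.exp_add]
    ring_nf
  have hsum : ∀ t : ℝ, 0 < t → HasSum (fun n => f n t) 0 := by
    intro t ht
    have h1 := (hs t ht).hasSum.mul_right (Complex.exp (-(A.ev k * t)))
    rw [A.tsum_exp_eq_zero_of_eq_zero_on_Ioo hτ hs h0 ht, zero_mul] at h1
    simpa only [hfeq] using h1
  have hbs : Summable fun n => ‖f n 1‖ := (hsum 1 one_pos).summable.norm
  have hre : ∀ n, k ≤ n → (A.ev n - A.ev k).re ≤ 0 := fun n hn => by
    rw [Complex.sub_re, sub_nonpos]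
    exact A.antitone_re hn
  have hfb : ∀ n, ∀ t : ℝ, 1 ≤ t → ‖f n t‖ ≤ ‖f n 1‖ := by
    intro n t ht
    rcases lt_or_ge n k with hn | hn
    · simp [hf, hk n hn]
    · simp only [hf, norm_mul, Complex.norm_exp, Complex.re_mul_ofReal]
      refine mul_le_mul_of_nonneg_left (Real.exp_le_exp.2 ?_) (norm_nonneg _)
      nlinarith [hre n hn]
  have hint : ∀ T : ℝ, 1 ≤ T → HasSum (fun n => ∫ t in (1 : ℝ)..T, f n t) 0 := by
    intro T hT
    have h1 := intervalIntegral.hasSum_integral_of_dominated_convergence (a := (1 : ℝ)) (b := T)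
      (μ := MeasureTheory.volume) (F := f) (f := fun _ => 0) (fun n _ => ‖f n 1‖)
      (fun n => Continuous.aestronglyMeasurable (by simp only [hf]; fun_prop))
      (fun n => Eventually.of_forall fun t ht => hfb n t ?_)
      (Eventually.of_forall fun _ _ => hbs) intervalIntegrable_const
      (Eventually.of_forall fun t ht => hsum t ?_)
    · simpa using h1
    · rw [Set.uIoc_of_le hT] at ht
      exact ht.1.le
    · rw [Set.uIoc_of_le hT] at ht
      linarith [ht.1]
  have hlim : Tendsto (fun T : ℝ => ∑' n, (T : ℂ)⁻¹ * ∫ t in (1 : ℝ)..T, f n t) atTop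
      (𝓝 (∑' n, (if A.ev n = A.ev k then a n else 0))) := by
    refine tendsto_tsum_of_dominated_convergence hbs (fun n => ?_) ?_
    · rcases lt_or_ge n k with hn | hn
      · simp [hf, hk n hn]
      · have h1 := (tendsto_mean_exp (hre n hn)).const_mul (a n)
        simp only [sub_eq_zero, mul_ite, mul_one, mul_zero] at h1
        refine h1.congr fun T => ?_
        simp only [hf, intervalIntegral.integral_const_mul]
        ring
    · filter_upwards [eventually_ge_atTop 1] with T hT n
      have h1 : ‖∫ t in (1 : ℝ)..T, f n t‖ ≤ ‖f n 1‖ * |T - 1| :=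
        intervalIntegral.norm_integral_le_of_norm_le_const fun t ht => by
          rw [Set.uIoc_of_le hT] at ht
          exact hfb n t ht.1.le
      rw [abs_of_nonneg (by linarith)] at h1
      rw [norm_mul, norm_inv, Complex.norm_real, Real.norm_of_nonneg (by linarith),
        inv_mul_le_iff₀ (by linarith)]
      nlinarith [norm_nonneg (f n 1)]
  refine tendsto_nhds_unique hlim (tendsto_const_nhds.congr' ?_)
  filter_upwards [eventually_ge_atTop 1] with T hT
  rw [tsum_mul_left, (hint T hT).tsum_eq, mul_zero]

variable [CompleteSpace H]

/-! ### Orbits of functionals under the semigroup -/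

/-- The Riesz representation in the graph space: every `f` in `D(A)'` is `φ ↦ ⟨φ, x⟩ + ⟨A φ, h⟩`
for some `x` and `h` in `H`. -/
theorem exists_repr_dual (A : DiagonalParabolic H) (f : A.Dual) :
    ∃ x h : H, f = A.incl x + A.transpose A.toImage A.norm_toImage_le h := by
  let f' : StrongDual ℂ A.Dom :=
    { toFun := fun φ => conj (f φ)
      map_add' := fun φ ψ => by simp
      map_smul' := fun c φ => by simp
      cont := Complex.continuous_conj.comp f.continuous }
  set g := (InnerProductSpace.toDual ℂ A.Dom).symm f' with hg
  refine ⟨A.toH g, A.toImage g, ?_⟩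
  ext φ
  have h1 : f φ = inner ℂ φ g := by
    rw [← inner_conj_symm φ g, hg, InnerProductSpace.toDual_symm_apply]
    exact (Complex.conj_conj _).symm
  exact h1.trans (A.inner_dom φ g)

theorem transpose_toImage_coeff (A : DiagonalParabolic H) (h : H) (n : ℕ) :
    A.transpose A.toImage A.norm_toImage_le h (A.eDom n) =
      conj (A.ev n) * inner ℂ (A.e n) h := by
  rw [A.transpose_apply, A.toImage_eDom, inner_smul_left]

/-- The smoothing effect: for `t > 0` the orbit `exp(t A) f` of `f` in `D(A)'` lies in `H`, and is
continuous there. -/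
theorem exists_smooth_orbit (A : DiagonalParabolic H) (f : A.Dual) :
    ∃ S : ℝ → H, ContinuousOn S (Set.Ioi 0) ∧
      ∀ t, 0 < t → ∀ n, inner ℂ (A.e n) (S t) = Complex.exp (A.ev n * t) * f (A.eDom n) := by
  obtain ⟨x, h, rfl⟩ := A.exists_repr_dual f
  set f := A.incl x + A.transpose A.toImage A.norm_toImage_le h with hf
  set a : ℕ → ℝ := fun n => ‖inner ℂ (A.e n) x‖ + ‖inner ℂ (A.e n) h‖ with ha
  have hfn : ∀ n, ‖f (A.eDom n)‖ ≤ (1 + ‖A.ev n‖) * a n := by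
    intro n
    rw [hf, add_apply, A.incl_coeff, A.transpose_toImage_coeff]
    refine (norm_add_le _ _).trans ?_
    rw [norm_mul, RCLike.norm_conj]
    nlinarith [mul_nonneg (norm_nonneg (A.ev n)) (norm_nonneg (inner ℂ (A.e n) x)),
      norm_nonneg (inner ℂ (A.e n) h)]
  have hb : ∀ δ T : ℝ, 0 < δ → ∃ K : ℝ, ∀ n, ∀ t ∈ Set.Icc δ T,
      ‖Complex.exp (A.ev n * t) * f (A.eDom n)‖ ≤ K * a n := by
    intro δ T hδ
    obtain ⟨K, hK⟩ := A.exists_norm_ev_mul_exp_le (T := T) hδ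
    refine ⟨K, fun n t ht => ?_⟩
    rw [norm_mul]
    calc _ ≤ ‖Complex.exp (A.ev n * t)‖ * ((1 + ‖A.ev n‖) * a n) := by
          gcongr
          exact hfn n
      _ = (1 + ‖A.ev n‖) * ‖Complex.exp (A.ev n * t)‖ * a n := by ring
      _ ≤ _ := mul_le_mul_of_nonneg_right (hK n t ht) (by positivity)
  have hs : ∀ K : ℝ, Summable fun n => (K * a n) ^ 2 := by
    intro K
    simp only [mul_pow]
    refine Summable.mul_left _ (Summable.of_nonneg_of_le (fun _ => by positivity) (fun n => ?_)
      (((A.hasSum_norm_sq x).summable.add (A.hasSum_norm_sq h).summable).mul_left 2))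
    exact add_sq_le
  have hex : ∀ t : ℝ, 0 < t → ∃ y : H, ∀ n, inner ℂ (A.e n) y =
      Complex.exp (A.ev n * t) * f (A.eDom n) := by
    intro t ht
    obtain ⟨K, hK⟩ := hb t t ht
    exact A.exists_coeff (Summable.of_nonneg_of_le (fun _ => by positivity)
      (fun n => pow_le_pow_left₀ (norm_nonneg _) (hK n t ⟨le_rfl, le_rfl⟩) 2) (hs K))
  choose! S hS using hex
  refine ⟨S, fun t₀ ht₀ => ContinuousAt.continuousWithinAt ?_, hS⟩
  have ht₀' : (0 : ℝ) < t₀ := ht₀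
  obtain ⟨K, hK⟩ := hb (t₀ / 2) (t₀ + 1) (by positivity)
  have hpos : ∀ t ∈ Set.Icc (t₀ / 2) (t₀ + 1), 0 < t := fun t ht => by linarith [ht.1]
  refine (A.continuousOn_of_coeff (s := Set.Icc (t₀ / 2) (t₀ + 1)) (hs K) (fun n => ?_)
    fun n t ht => ?_).continuousAt (Icc_mem_nhds (by linarith) (by linarith))
  · refine ContinuousOn.congr (f := fun t : ℝ => Complex.exp (A.ev n * t) * f (A.eDom n))
      (Continuous.continuousOn (by fun_prop)) fun t ht => hS t (hpos t ht) n
  · rw [hS t (hpos t ht)]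
    exact hK n t ht

/-! ### The Fattorini–Hautus test -/

/-- The Fattorini–Hautus test: no eigenvector of `A*` is annihilated by all the `B j`. -/
def FattoriniHautus (A : DiagonalParabolic H) {m : ℕ} (B : Fin m → A.Dual) : Prop :=
  ∀ (μ : ℂ) (v : A.Dom), A.adj v = conj μ • A.toH v → (∀ j, B j v = 0) → v = 0

theorem ev_eq_of_adj_eq (A : DiagonalParabolic H) {μ : ℂ} {v : A.Dom}
    (hv : A.adj v = conj μ • A.toH v) {n : ℕ} (hn : inner ℂ (A.e n) (A.toH v) ≠ 0) :
    A.ev n = μ := by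
  have h := A.inner_adj v n
  rw [hv, inner_smul_right] at h
  exact (star_injective (mul_right_cancel₀ hn h)).symm

theorem finite_ev_eq (A : DiagonalParabolic H) (μ : ℂ) : {n | A.ev n = μ}.Finite :=
  (A.finite_low (-μ.re)).subset fun n hn => by
    rw [Set.mem_ofPred_eq] at hn
    simp [hn]

/-- The eigenvector of `A*` for the eigenvalue `conj μ` with coefficients `c n`. -/
noncomputable def eigenDom (A : DiagonalParabolic H) (μ : ℂ) (c : ℕ → ℂ) : A.Dom :=
  ∑ n ∈ (A.finite_ev_eq μ).toFinset, c n • A.eDom n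

theorem inner_eigenDom (A : DiagonalParabolic H) (μ : ℂ) (c : ℕ → ℂ) (n : ℕ) :
    inner ℂ (A.e n) (A.toH (A.eigenDom μ c)) = if A.ev n = μ then c n else 0 := by
  simp [eigenDom, map_sum, A.toH_eDom, A.inner_e_e]

theorem adj_eigenDom (A : DiagonalParabolic H) (μ : ℂ) (c : ℕ → ℂ) :
    A.adj (A.eigenDom μ c) = conj μ • A.toH (A.eigenDom μ c) := by
  refine A.ext_coeff fun n => ?_
  rw [A.inner_adj, inner_smul_right, A.inner_eigenDom]
  split_ifs with h
  · rw [h]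
  · simp

theorem dual_eigenDom (A : DiagonalParabolic H) (f : A.Dual) (μ : ℂ) (c : ℕ → ℂ) :
    f (A.eigenDom μ c) = ∑ n ∈ (A.finite_ev_eq μ).toFinset, conj (c n) * f (A.eDom n) := by
  simp [eigenDom, map_sum]

/-! ### The commutant and the test -/

theorem e_mem_highH (A : DiagonalParabolic H) {lam : ℝ} {n : ℕ} (hn : (A.ev n).re < -lam) :
    A.e n ∈ A.highH lam :=
  Submodule.le_topologicalClosure _ (Submodule.subset_span ⟨n, hn, rfl⟩)

theorem coeff_eq_zero_of_mem_highDual (A : DiagonalParabolic H) {lam : ℝ} {f : A.Dual}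
    (hf : f ∈ A.highDual lam) {n : ℕ} (hn : -lam ≤ (A.ev n).re) : f (A.eDom n) = 0 := by
  have hle : A.highDual lam ≤
      LinearMap.ker (ContinuousLinearMap.apply' ℂ (starRingEnd ℂ) (A.eDom n)).toLinearMap := by
    refine Submodule.topologicalClosure_minimal _ (Submodule.span_le.2 ?_)
      (ContinuousLinearMap.isClosed_ker _)
    rintro _ ⟨k, hk, rfl⟩
    change A.incl (A.e k) (A.eDom n) = 0
    rw [A.incl_coeff, A.inner_e_e, if_neg]
    rintro rfl
    exact absurd hn (not_le.2 hk)
  exact hle hf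

/-- Continuous linear maps on `D(A)'_lam` are determined by their values at the `e n`. -/
theorem highDual_hom_ext (A : DiagonalParabolic H) {lam : ℝ} {F : Type*} [NormedAddCommGroup F]
    [NormedSpace ℂ F] {S T : A.highDual lam →L[ℂ] F}
    (h : ∀ n (hn : (A.ev n).re < -lam), S (A.inclHigh lam ⟨A.e n, A.e_mem_highH hn⟩) =
      T (A.inclHigh lam ⟨A.e n, A.e_mem_highH hn⟩)) : S = T := by
  ext ⟨f, hf⟩
  set V := Submodule.span ℂ ((fun n => A.incl (A.e n)) '' {n | (A.ev n).re < -lam}) with hV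
  have hVle : V ≤ A.highDual lam := Submodule.le_topologicalClosure _
  have hVeq : ∀ g (hg : g ∈ V), S ⟨g, hVle hg⟩ = T ⟨g, hVle hg⟩ := by
    intro g hg
    induction hg using Submodule.span_induction with
    | mem g hg =>
      obtain ⟨n, hn, rfl⟩ := hg
      exact h n hn
    | zero => exact (map_zero S).trans (map_zero T).symm
    | add x y hx hy hx' hy' =>
      have hS := map_add S ⟨x, hVle hx⟩ ⟨y, hVle hy⟩
      have hT := map_add T ⟨x, hVle hx⟩ ⟨y, hVle hy⟩
      rw [hx', hy', ← hT] at hS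
      exact hS
    | smul c x hx hx' =>
      have hS := map_smul S c ⟨x, hVle hx⟩
      have hT := map_smul T c ⟨x, hVle hx⟩
      rw [hx', ← hT] at hS
      exact hS
  have hdense : Dense {g : A.highDual lam | (g : A.Dual) ∈ V} := by
    rw [Topology.IsInducing.subtypeVal.dense_iff]
    rintro ⟨g, hg⟩
    refine closure_mono ?_ (show g ∈ closure (V : Set A.Dual) from hg)
    intro x hx
    exact ⟨⟨x, hVle hx⟩, hx, rfl⟩
  exact congrFun (S.continuous.ext_on hdense T.continuous fun g hg => hVeq g.1 hg) ⟨f, hf⟩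

/-- Low-frequency coefficients do not contribute to the value at a high-frequency eigenvector. -/
theorem highPart_apply (A : DiagonalParabolic H) {lam : ℝ} (f : A.Dual) {φ : A.Dom}
    (hφ : ∀ n, -lam ≤ (A.ev n).re → inner ℂ (A.e n) (A.toH φ) = 0) :
    (A.highPart lam f : A.Dual) φ = f φ := by
  have h : A.lowPart lam f φ = 0 := by
    rw [lowPart, sum_apply]
    refine Finset.sum_eq_zero fun n hn => ?_
    have h1 : A.incl (A.e n) φ = 0 := by
      change inner ℂ (A.toH φ) (A.e n) = 0
      rw [← inner_conj_symm, hφ n (A.mem_low.1 hn), map_zero]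
    rw [smul_apply, h1, smul_zero]
  change (f - A.lowPart lam f) φ = f φ
  rw [sub_apply, h, sub_zero]

/-- An eigenvector of `A*` annihilated by `B` yields the rank-one operator `f ↦ f(v) e_n` of
`N_{B_H}`, `e_n` belonging to the same eigenvalue. -/
theorem eq_zero_of_annihilator_eq (A : DiagonalParabolic H) {lam : ℝ} {m : ℕ}
    {B : Fin m → A.Dual} (hN : A.annihilator lam B = {0}) {μ : ℂ} (hμ : μ.re < -lam) {v : A.Dom}
    (hv : A.adj v = conj μ • A.toH v) (hBv : ∀ j, B j v = 0) : v = 0 := by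
  by_contra hv0
  obtain ⟨n, hn⟩ : ∃ n, inner ℂ (A.e n) (A.toH v) ≠ 0 := by
    by_contra! h
    exact hv0 (A.ext_dom fun n => by simp [h n])
  have hnμ : A.ev n = μ := A.ev_eq_of_adj_eq hv hn
  have hnlow : (A.ev n).re < -lam := by rwa [hnμ]
  set en : A.highH lam := ⟨A.e n, A.e_mem_highH hnlow⟩ with hen
  set ev : A.highDual lam →L[ℂ] ℂ :=
    (ContinuousLinearMap.apply' ℂ (starRingEnd ℂ) v) ∘L (A.highDual lam).subtypeL with hev
  have hev_apply : ∀ f : A.highDual lam, ev f = (f : A.Dual) v := fun _ => rfl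
  set M : A.highDual lam →L[ℂ] A.highDual lam := ev.smulRight (A.inclHigh lam en) with hM
  have hMmem : M ∈ A.annihilator lam B := by
    refine ⟨⟨((innerSL ℂ (A.toH v)) ∘L (A.highH lam).subtypeL).smulRight en, fun x => ?_,
      fun x => ?_⟩, fun j => ?_⟩
    · exact (map_smul (A.inclHigh lam) (inner ℂ (A.toH v) (x : H)) en).symm
    · have h1 : A.opHigh lam en = μ • A.inclHigh lam en := by
        refine Subtype.ext (A.ext_dual fun k => ?_)
        change A.opExt (A.e n) (A.eDom k) = μ * A.incl (A.e n) (A.eDom k)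
        rw [A.opExt_coeff, A.incl_coeff, A.inner_e_e]
        split_ifs with h
        · rw [h, hnμ]
        · simp
      have h2 : ev (A.opHigh lam x) = inner ℂ (A.toH v) (x : H) * μ := by
        change inner ℂ (A.adj v) (x : H) = _
        rw [hv, inner_smul_left, Complex.conj_conj, mul_comm]
      change A.opHigh lam (inner ℂ (A.toH v) (x : H) • en) =
        ev (A.opHigh lam x) • A.inclHigh lam en
      rw [map_smul, h1, h2, smul_smul]
    · change ev (A.highPart lam (B j)) • A.inclHigh lam en = 0
      rw [hev_apply, A.highPart_apply, hBv, zero_smul]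
      intro k hk
      by_contra h
      rw [A.ev_eq_of_adj_eq hv h] at hk
      linarith
  rw [hN, Set.mem_singleton_iff] at hMmem
  have h1 : ((M (A.inclHigh lam en) : A.highDual lam) : A.Dual) (A.eDom n) =
      inner ℂ (A.toH v) (A.e n) * inner ℂ (A.e n) (A.e n) := rfl
  rw [hMmem, A.inner_e_e, if_pos rfl, mul_one, ← inner_conj_symm] at h1
  exact hn ((map_eq_zero _).1 h1.symm)

/-- Low-frequency eigenvectors pass the test by admissibility: each of the sequences contains
at most one eigenvector of a given low-frequency eigenvalue. -/
theorem eq_zero_of_isFAdmissible {A : DiagonalParabolic H} {lam : ℝ} {P : A.FreqDecomposition lam}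
    {B : Fin (A.maxMult lam) → A.Dual} (hB : IsFAdmissible P B) {μ : ℂ} (hμ : -lam ≤ μ.re)
    {v : A.Dom} (hv : A.adj v = conj μ • A.toH v) (hBv : ∀ j, B j v = 0) : v = 0 := by
  refine A.ext_dom fun n => ?_
  rw [map_zero, inner_zero_right]
  by_contra hn
  obtain ⟨⟨j, k⟩, rfl⟩ := P.σ.surjective n
  have hnμ := A.ev_eq_of_adj_eq hv hn
  have hkN : k < P.N j := (P.low_iff j k).2 (by rwa [hnμ])
  have h1 := A.hasSum_dual (B j) v
  rw [hBv j] at h1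
  refine mul_ne_zero ((map_ne_zero conj).2 hn) ((hB j).2 k hkN)
    ((hasSum_single (P.σ (j, k)) fun i hi => ?_).unique h1)
  obtain ⟨⟨j', l⟩, rfl⟩ := P.σ.surjective i
  by_cases hj : j' = j
  · subst hj
    by_cases h2 : inner ℂ (A.e (P.σ (j', l))) (A.toH v) = 0
    · rw [h2, map_zero, zero_mul]
    · have hlμ := A.ev_eq_of_adj_eq hv h2
      have hlN : l < P.N j' := (P.low_iff j' l).2 (by rwa [hlμ])
      exact absurd (by rw [P.simple j' l k hlN hkN (hlμ.trans hnμ.symm)]) hi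
  · rw [(hB j).1 _ fun k' => ?_, mul_zero]
    rw [A.toH_eDom, A.inner_e_e, if_neg]
    intro h
    exact hj (congrArg Prod.fst (P.σ.injective h)).symm

theorem fattoriniHautus_of_annihilator_eq {A : DiagonalParabolic H} {lam : ℝ}
    {P : A.FreqDecomposition lam} {B : Fin (A.maxMult lam) → A.Dual} (hB : IsFAdmissible P B)
    (hN : A.annihilator lam B = {0}) : A.FattoriniHautus B := fun μ _ hv hBv =>
  (lt_or_ge μ.re (-lam)).elim (fun h => A.eq_zero_of_annihilator_eq hN h hv hBv)
    fun h => eq_zero_of_isFAdmissible hB h hv hBv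

/-- An operator `M` of the commutant preserves the eigenspaces, so that each of its rows
`f ↦ (M f)(e k)` is the evaluation at an eigenvector of `A*`. -/
theorem annihilator_eq_of_fattoriniHautus (A : DiagonalParabolic H) (lam : ℝ) {m : ℕ}
    {B : Fin m → A.Dual} (hB : A.FattoriniHautus B) : A.annihilator lam B = {0} := by
  ext M
  rw [Set.mem_singleton_iff]
  constructor
  · rintro ⟨⟨R, hR, hAR⟩, hMB⟩
    set row : ℕ → (A.highDual lam →L[ℂ] ℂ) := fun k =>
      (ContinuousLinearMap.apply' ℂ (starRingEnd ℂ) (A.eDom k)) ∘L (A.highDual lam).subtypeL ∘L M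
      with hrow
    have hrow_apply : ∀ k f, row k f = (M f : A.Dual) (A.eDom k) := fun _ _ => rfl
    have hrow_zero : ∀ k, row k = 0 := by
      intro k
      rcases lt_or_ge (A.ev k).re (-lam) with hk | hk
      · -- The matrix entries of `M` between `e k` and the other eigenvectors.
        set c : ℕ → ℂ := fun n =>
          if hn : (A.ev n).re < -lam then
            row k (A.inclHigh lam ⟨A.e n, A.e_mem_highH hn⟩) else 0 with hc
        set v := A.eigenDom (A.ev k) fun n => conj (c n) with hv
        have hrow_eq : row k = (ContinuousLinearMap.apply' ℂ (starRingEnd ℂ) v) ∘L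
            (A.highDual lam).subtypeL := by
          refine A.highDual_hom_ext fun n hn => ?_
          have h1 : ((ContinuousLinearMap.apply' ℂ (starRingEnd ℂ) v) ∘L
              (A.highDual lam).subtypeL) (A.inclHigh lam ⟨A.e n, A.e_mem_highH hn⟩) =
              inner ℂ (A.toH v) (A.e n) := rfl
          rw [h1, ← inner_conj_symm, hv, A.inner_eigenDom]
          split_ifs with h
          · rw [Complex.conj_conj, hc]
            simp only [dif_pos hn]
          · have h2 := congrArg (fun f : A.highDual lam => (f : A.Dual) (A.eDom k))
              (hAR ⟨A.e n, A.e_mem_highH hn⟩)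
            have h3 : A.opHigh lam ⟨A.e n, A.e_mem_highH hn⟩ =
                A.ev n • A.inclHigh lam ⟨A.e n, A.e_mem_highH hn⟩ := by
              refine Subtype.ext (A.ext_dual fun i => ?_)
              change A.opExt (A.e n) (A.eDom i) = A.ev n * A.incl (A.e n) (A.eDom i)
              rw [A.opExt_coeff, A.incl_coeff, A.inner_e_e]
              split_ifs with h
              · rw [h]
              · simp
            rw [h3, map_smul, hR] at h2
            change A.opExt _ (A.eDom k) = A.ev n * A.incl _ (A.eDom k) at h2
            rw [A.opExt_coeff, A.incl_coeff] at h2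
            rw [hrow_apply, hR, map_zero]
            change inner ℂ (A.e k) _ = 0
            by_contra h4
            exact h (mul_right_cancel₀ h4 h2).symm
        have hv0 : v = 0 := by
          refine hB (A.ev k) v (A.adj_eigenDom _ _) fun j => ?_
          rw [← A.highPart_apply (lam := lam)]
          · have h1 := congrArg (fun T : A.highDual lam →L[ℂ] ℂ => T (A.highPart lam (B j))) hrow_eq
            refine h1.symm.trans ?_
            simp only [hrow_apply, hMB j]
            rfl
          · intro n hn
            rw [hv, A.inner_eigenDom, if_neg]
            rintro h
            rw [h] at hn
            linarith
        rw [hrow_eq, hv0]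
        ext f
        exact map_zero (f : A.Dual)
      · ext f
        exact A.coeff_eq_zero_of_mem_highDual (M f).2 hk
    ext1 f
    refine Subtype.ext (A.ext_dual fun k => ?_)
    exact congrArg (fun T : A.highDual lam →L[ℂ] ℂ => T f) (hrow_zero k)
  · rintro rfl
    exact ⟨⟨0, fun x => by simp, fun x => by simp⟩, fun j => rfl⟩

/-! ### Controllability implies the test -/

theorem eq_zero_of_eq_mul_integral {μ : ℂ} {τ : ℝ} {y : ℝ → ℂ}
    (hy : ContinuousOn y (Set.Icc 0 τ))
    (h : ∀ t ∈ Set.Icc 0 τ, y t = μ * ∫ s in (0 : ℝ)..t, y s) {t : ℝ} (ht : t ∈ Set.Icc 0 τ) :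
    y t = 0 := by
  have hτ : 0 ≤ τ := ht.1.trans ht.2
  set x : ℝ → ℂ := Set.IccExtend hτ ((Set.Icc 0 τ).domRestrict y) with hx
  have hxc : Continuous x := hy.domRestrict.Icc_extend'
  have hxy : ∀ s ∈ Set.Icc 0 τ, x s = y s := fun s hs => Set.IccExtend_of_mem hτ _ hs
  have hint : ∀ s ∈ Set.Icc 0 τ, ∫ r in (0 : ℝ)..s, y r = ∫ r in (0 : ℝ)..s, x r := by
    intro s hs
    refine intervalIntegral.integral_congr fun r hr => ?_
    rw [Set.uIcc_of_le hs.1] at hr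
    exact (hxy r ⟨hr.1, hr.2.trans hs.2⟩).symm
  have hd : ∀ s : ℝ, HasDerivAt (fun s : ℝ => Complex.exp (-μ * s) * ∫ r in (0 : ℝ)..s, x r)
      (Complex.exp (-μ * s) * (-μ * 1) * (∫ r in (0 : ℝ)..s, x r) +
        Complex.exp (-μ * s) * x s) s := fun s =>
    (((Complex.ofRealCLM.hasDerivAt (x := s)).const_mul (-μ)).cexp).mul
      (intervalIntegral.integral_hasDerivAt_right (hxc.intervalIntegrable _ _)
        (hxc.stronglyMeasurableAtFilter _ _) hxc.continuousAt)
  have hconst := constant_of_has_deriv_right_zero (a := 0) (b := τ)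
    (fun s _ => (hd s).continuousAt.continuousWithinAt) (fun s hs => by
      have hs' : s ∈ Set.Icc 0 τ := ⟨hs.1, hs.2.le⟩
      convert (hd s).hasDerivWithinAt using 1
      rw [hxy s hs', h s hs', hint s hs']
      ring) t ht
  rw [intervalIntegral.integral_same, mul_zero] at hconst
  rw [h t ht, hint t ht, (mul_eq_zero.1 hconst).resolve_left (Complex.exp_ne_zero _), mul_zero]

theorem fattoriniHautus_of_isApproxControllable (A : DiagonalParabolic H) {m : ℕ}
    {B : Fin m → A.Dual} {τ : ℝ} (hτ : 0 < τ) (hB : A.IsApproxControllable B τ) :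
    A.FattoriniHautus B := by
  intro μ v hv hBv
  by_contra hv0
  have hv1 : A.toH v ≠ 0 := fun h => hv0 (A.ext_dom fun n => by rw [h, map_zero])
  have hpos : 0 < ‖A.toH v‖ := norm_pos_iff.2 hv1
  obtain ⟨w, -, u, ⟨huc, hu⟩, y, huy, hyv⟩ := hB 0 (A.toH v) (‖A.toH v‖ / 2) (by positivity)
  -- The component of the solution along `v` does not feel the control.
  have h0 : u τ v = 0 := by
    refine eq_zero_of_eq_mul_integral (μ := μ) (y := fun t => u t v) (τ := τ)
      ((ContinuousLinearMap.apply' ℂ (starRingEnd ℂ) v).continuous.comp_continuousOn huc)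
      (fun t ht => ?_) ⟨hτ.le, le_rfl⟩
    have h1 := hu v (conj μ • v) (by rw [map_smul, hv]) t ht
    simp only [map_zero, zero_apply, zero_add, map_smulₛₗ, Complex.conj_conj, smul_eq_mul,
      sum_apply, smul_apply, hBv, mul_zero, Finset.sum_const_zero, add_zero,
      intervalIntegral.integral_const_mul] at h1
    exact h1
  rw [huy] at h0
  have h2 : inner ℂ (A.toH v) y = 0 := h0
  have h3 : inner ℂ (A.toH v) (A.toH v - y) = ((‖A.toH v‖ ^ 2 : ℝ) : ℂ) := by
    rw [inner_sub_right, h2, sub_zero, inner_self_eq_norm_sq_to_K]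
    norm_cast
  have h4 := norm_inner_le_norm (𝕜 := ℂ) (A.toH v) (A.toH v - y)
  rw [h3, Complex.norm_real, Real.norm_of_nonneg (by positivity), norm_sub_rev] at h4
  nlinarith

/-! ### Solutions for continuous controls -/

theorem IsSolution.add {A : DiagonalParabolic H} {m : ℕ} {B : Fin m → A.Dual} {τ : ℝ} {u₀ v₀ : H}
    {w x : ℝ → EuclideanSpace ℂ (Fin m)} {u v : ℝ → A.Dual} (hw : Continuous w) (hx : Continuous x)
    (hu : A.IsSolution B τ u₀ w u) (hv : A.IsSolution B τ v₀ x v) :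
    A.IsSolution B τ (u₀ + v₀) (w + x) (u + v) := by
  refine ⟨hu.1.add hv.1, fun φ ψ hφ t ht => ?_⟩
  have hint : ∀ {w : ℝ → EuclideanSpace ℂ (Fin m)} {u : ℝ → A.Dual}, Continuous w →
      ContinuousOn u (Set.Icc 0 τ) → IntervalIntegrable
        (fun s => u s ψ + (∑ j, w s j • B j) φ) MeasureTheory.volume 0 t := by
    intro w u hw hu
    refine ContinuousOn.intervalIntegrable ?_
    rw [Set.uIcc_of_le ht.1]
    refine (((ContinuousLinearMap.apply' ℂ (starRingEnd ℂ) ψ).continuous.comp_continuousOn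
      (hu.mono (Set.Icc_subset_Icc_right ht.2))).add (Continuous.continuousOn ?_))
    simp only [sum_apply, smul_apply]
    fun_prop
  rw [Pi.add_apply, add_apply, hu.2 φ ψ hφ t ht, hv.2 φ ψ hφ t ht, map_add, add_apply,
    add_add_add_comm, ← intervalIntegral.integral_add (hint hw hu.1) (hint hx hv.1)]
  congr 2
  funext s
  simp only [Pi.add_apply, add_apply, PiLp.add_apply, add_smul, sum_apply, smul_apply,
    Finset.sum_add_distrib]
  ring

theorem IsSolution.smul {A : DiagonalParabolic H} {m : ℕ} {B : Fin m → A.Dual} {τ : ℝ} {u₀ : H}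
    {w : ℝ → EuclideanSpace ℂ (Fin m)} {u : ℝ → A.Dual} (c : ℂ)
    (hu : A.IsSolution B τ u₀ w u) : A.IsSolution B τ (c • u₀) (c • w) (c • u) := by
  refine ⟨hu.1.const_smul c, fun φ ψ hφ t ht => ?_⟩
  rw [Pi.smul_apply, smul_apply, hu.2 φ ψ hφ t ht, map_smul, smul_apply, smul_add,
    ← intervalIntegral.integral_smul]
  congr 2
  funext s
  simp only [Pi.smul_apply, smul_apply, PiLp.smul_apply, smul_assoc, ← Finset.smul_sum, smul_add]

/-- Against pairs `(φ, A* φ)`, an identity between functionals can be tested on eigenvectors. -/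
theorem dual_eq_of_adj (A : DiagonalParabolic H) {f g : A.Dual}
    (h : ∀ n, f (A.eDom n) = A.ev n * g (A.eDom n)) {φ ψ : A.Dom} (hφ : A.toH ψ = A.adj φ) :
    f φ = g ψ := by
  refine (A.hasSum_dual f φ).unique ((A.hasSum_dual g ψ).congr_fun ?_)
  intro n
  rw [hφ, A.inner_adj, h, map_mul, Complex.conj_conj]
  ring

/-- The weak equation follows from the scalar equations of the coefficients. The solution is given
through the representation of `exists_repr_dual`, which keeps all integrals in `H`. -/
theorem isSolution_of_coeff (A : DiagonalParabolic H) {m : ℕ} {B : Fin m → A.Dual} {τ : ℝ} {u₀ : H}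
    {w : ℝ → EuclideanSpace ℂ (Fin m)} {X Y : ℝ → H} (hw : Continuous w)
    (hX : ContinuousOn X (Set.Icc 0 τ)) (hY : ContinuousOn Y (Set.Icc 0 τ)) (y : ℕ → ℝ → ℂ)
    (hXY : ∀ n, ∀ t ∈ Set.Icc 0 τ,
      inner ℂ (A.e n) (X t) + conj (A.ev n) * inner ℂ (A.e n) (Y t) = y n t)
    (hy0 : ∀ n, y n 0 = inner ℂ (A.e n) u₀)
    (hy : ∀ n t, HasDerivAt (y n) (A.ev n * y n t + ∑ j, w t j * B j (A.eDom n)) t) :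
    A.IsSolution B τ u₀ w
      fun t => A.incl (X t) + A.transpose A.toImage A.norm_toImage_le (Y t) := by
  refine ⟨(A.incl.continuous.comp_continuousOn hX).add
      ((A.transpose A.toImage A.norm_toImage_le).continuous.comp_continuousOn hY),
    fun φ ψ hφ t ht => ?_⟩
  have hint : ∀ {Z : ℝ → H}, ContinuousOn Z (Set.Icc 0 τ) →
      IntervalIntegrable Z MeasureTheory.volume 0 t := by
    intro Z hZ
    refine ContinuousOn.intervalIntegrable ?_
    rw [Set.uIcc_of_le ht.1]
    exact hZ.mono (Set.Icc_subset_Icc_right ht.2)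
  have hinner : ∀ {Z : ℝ → H}, ContinuousOn Z (Set.Icc 0 τ) → ∀ x : H,
      IntervalIntegrable (fun s => inner ℂ x (Z s)) MeasureTheory.volume 0 t ∧
        inner ℂ x (∫ s in (0 : ℝ)..t, Z s) = ∫ s in (0 : ℝ)..t, inner ℂ x (Z s) := by
    intro Z hZ x
    refine ⟨?_, ((innerSL ℂ x).intervalIntegral_comp_comm (hint hZ)).symm⟩
    refine ContinuousOn.intervalIntegrable ?_
    rw [Set.uIcc_of_le ht.1]
    exact ((innerSL ℂ x).continuous.comp_continuousOn hZ).mono (Set.Icc_subset_Icc_right ht.2)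
  set U : A.Dual := A.incl (∫ s in (0 : ℝ)..t, X s) +
    A.transpose A.toImage A.norm_toImage_le (∫ s in (0 : ℝ)..t, Y s) with hU
  set W : A.Dual := ∑ j, (∫ s in (0 : ℝ)..t, w s j) • B j with hW
  have hUχ : ∀ χ : A.Dom, U χ = ∫ s in (0 : ℝ)..t,
      (inner ℂ (A.toH χ) (X s) + inner ℂ (A.toImage χ) (Y s)) := by
    intro χ
    rw [intervalIntegral.integral_add (hinner hX _).1 (hinner hY _).1, ← (hinner hX _).2,
      ← (hinner hY _).2]
    rfl
  have hwj : ∀ χ : A.Dom, ∀ j, IntervalIntegrable (fun s => w s j * B j χ)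
      MeasureTheory.volume 0 t := fun χ j => Continuous.intervalIntegrable (by fun_prop) _ _
  have hWχ : ∀ χ : A.Dom, W χ = ∫ s in (0 : ℝ)..t, ∑ j, w s j * B j χ := by
    intro χ
    rw [intervalIntegral.integral_finsetSum fun j _ => hwj χ j, hW, sum_apply]
    refine Finset.sum_congr rfl fun j _ => ?_
    rw [intervalIntegral.integral_mul_const]
    rfl
  have key := A.dual_eq_of_adj (f := A.incl (X t) +
    A.transpose A.toImage A.norm_toImage_le (Y t) - A.incl u₀ - W) (g := U) (fun n => ?_) hφ
  · rw [sub_apply, sub_apply, hWχ, hUχ] at key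
    have h1 : ∫ s in (0 : ℝ)..t, ((A.incl (X s) +
        A.transpose A.toImage A.norm_toImage_le (Y s)) ψ + (∑ j, w s j • B j) φ) =
        ∫ s in (0 : ℝ)..t, ((inner ℂ (A.toH ψ) (X s) + inner ℂ (A.toImage ψ) (Y s)) +
          ∑ j, w s j * B j φ) := by
      refine intervalIntegral.integral_congr fun s _ => ?_
      simp only [sum_apply, smul_apply, smul_eq_mul]
      rfl
    rw [h1, intervalIntegral.integral_add ((hinner hX _).1.add (hinner hY _).1)
      (Continuous.intervalIntegrable (by fun_prop) _ _), ← key]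
    ring
  · have hyc : Continuous (y n) := continuous_iff_continuousAt.2 fun s => (hy n s).continuousAt
    have h1 := intervalIntegral.integral_eq_sub_of_hasDerivAt (a := 0) (b := t)
      (fun s _ => hy n s) (Continuous.intervalIntegrable (by fun_prop) _ _)
    rw [intervalIntegral.integral_add (Continuous.intervalIntegrable (by fun_prop) _ _)
      (Continuous.intervalIntegrable (by fun_prop) _ _),
      intervalIntegral.integral_const_mul, hy0] at h1
    have h2 : U (A.eDom n) = ∫ s in (0 : ℝ)..t, y n s := by
      rw [hUχ]
      refine intervalIntegral.integral_congr fun s hs => ?_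
      rw [Set.uIcc_of_le ht.1] at hs
      rw [← hXY n s ⟨hs.1, hs.2.trans ht.2⟩, A.toH_eDom, A.toImage_eDom, inner_smul_left]
    rw [sub_apply, sub_apply, add_apply, hWχ, h2, A.incl_coeff, A.incl_coeff,
      A.transpose_toImage_coeff, hXY n t ht]
    linear_combination -h1

theorem exists_free_solution (A : DiagonalParabolic H) {m : ℕ} (B : Fin m → A.Dual) {τ : ℝ}
    (u₀ : H) : ∃ u : ℝ → A.Dual, A.IsSolution B τ u₀ 0 u ∧ ∃ y, u τ = A.incl y := by
  obtain ⟨S, hS, hS'⟩ := A.exists_orbit τ u₀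
  refine ⟨_, A.isSolution_of_coeff (Y := 0) continuous_zero hS continuousOn_const
    (fun n t => Complex.exp (A.ev n * t) * inner ℂ (A.e n) u₀)
    (fun n t ht => by simp [hS' t ht n]) (fun n => by simp) fun n t => ?_, S τ, ?_⟩
  · refine (((Complex.ofRealCLM.hasDerivAt (x := t)).const_mul (A.ev n)).cexp.mul_const
      (inner ℂ (A.e n) u₀)).congr_deriv ?_
    simp
    ring
  · rw [Pi.zero_apply, map_zero, add_zero]

/-- The convolution `∫₀ᵗ g(t - r) exp(r A) x dr` in `H`. -/
theorem exists_convolution (A : DiagonalParabolic H) {τ : ℝ} (hτ : 0 ≤ τ) {g : ℝ → ℂ}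
    (hg : Continuous g) (x : H) : ∃ X : ℝ → H, Continuous X ∧ ∀ t ∈ Set.Icc 0 τ, ∀ n,
      inner ℂ (A.e n) (X t) =
        (∫ r in (0 : ℝ)..t, g (t - r) * Complex.exp (A.ev n * r)) * inner ℂ (A.e n) x := by
  obtain ⟨S, hS, hS'⟩ := A.exists_orbit τ x
  set Ψ : ℝ → H := Set.IccExtend hτ ((Set.Icc 0 τ).domRestrict S) with hΨ
  have hΨc : Continuous Ψ := hS.domRestrict.Icc_extend'
  have hΨ' : ∀ t ∈ Set.Icc 0 τ, Ψ t = S t := fun t ht => Set.IccExtend_of_mem hτ _ ht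
  refine ⟨fun t => ∫ r in (0 : ℝ)..t, g (t - r) • Ψ r,
    intervalIntegral.continuous_parametric_intervalIntegral_of_continuous
      (by simp only [Function.uncurry_def]; fun_prop) continuous_id, fun t ht n => ?_⟩
  have h1 := (innerSL ℂ (A.e n)).intervalIntegral_comp_comm (a := 0) (b := t)
    (μ := MeasureTheory.volume) (f := fun r => g (t - r) • Ψ r)
    (Continuous.intervalIntegrable (by fun_prop) _ _)
  rw [← intervalIntegral.integral_mul_const]
  refine h1.symm.trans (intervalIntegral.integral_congr fun r hr => ?_)
  rw [Set.uIcc_of_le ht.1] at hr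
  have hr' : r ∈ Set.Icc 0 τ := ⟨hr.1, hr.2.trans ht.2⟩
  simp only [innerSL_apply_apply, inner_smul_right, hΨ' r hr', hS' r hr', mul_assoc]

/-- Duhamel's formula: for a control `s ↦ h (τ - s)` in the `j`-th channel, `h` vanishing near `0` so
that `r ↦ h(r) exp(r A) B_j` is continuous in `H`, the final state is `∫ h(r) exp(r A) B_j dr`. -/
theorem exists_forced_solution (A : DiagonalParabolic H) {m : ℕ} (B : Fin m → A.Dual) {τ : ℝ}
    (hτ : 0 ≤ τ) (j : Fin m) {h : ℝ → ℂ} (hh : Continuous h)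
    {S : ℝ → H} (hSc : Continuous fun r => h r • S r)
    (hS : ∀ t, 0 < t → ∀ n, inner ℂ (A.e n) (S t) = Complex.exp (A.ev n * t) * B j (A.eDom n)) :
    ∃ w : ℝ → EuclideanSpace ℂ (Fin m), Continuous w ∧ ∃ u : ℝ → A.Dual,
      A.IsSolution B τ 0 w u ∧ u τ = A.incl (∫ r in (0 : ℝ)..τ, h r • S r) := by
  obtain ⟨x, k, hB⟩ := A.exists_repr_dual (B j)
  have hBn : ∀ n, B j (A.eDom n) =
      inner ℂ (A.e n) x + conj (A.ev n) * inner ℂ (A.e n) k := fun n => by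
    rw [hB, add_apply, A.incl_coeff, A.transpose_toImage_coeff]
  set g : ℝ → ℂ := fun s => h (τ - s) with hg
  have hgc : Continuous g := by fun_prop
  obtain ⟨X, hXc, hX⟩ := A.exists_convolution hτ hgc x
  obtain ⟨Y, hYc, hY⟩ := A.exists_convolution hτ hgc k
  have hwc : Continuous fun s => g s • EuclideanSpace.single j (1 : ℂ) := by fun_prop
  refine ⟨_, hwc, _, A.isSolution_of_coeff hwc hXc.continuousOn hYc.continuousOn
      (fun n t => Complex.exp (A.ev n * t) *
        (∫ s in (0 : ℝ)..t, g s * Complex.exp (-A.ev n * s)) * B j (A.eDom n)) (fun n t ht => ?_)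
      (fun n => by simp) fun n t => ?_, ?_⟩
  · have h1 := intervalIntegral.integral_comp_sub_left (a := 0) (b := t)
      (fun r => g r * Complex.exp (A.ev n * (t - r : ℝ))) t
    simp only [sub_sub_cancel, sub_self, sub_zero] at h1
    have h2 : ∫ r in (0 : ℝ)..t, g r * Complex.exp (A.ev n * (t - r : ℝ)) =
        Complex.exp (A.ev n * t) * ∫ s in (0 : ℝ)..t, g s * Complex.exp (-A.ev n * s) := by
      rw [← intervalIntegral.integral_const_mul]
      congr 1
      funext s
      rw [Complex.ofReal_sub, mul_sub, sub_eq_add_neg, Complex.exp_add, neg_mul]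
      ring
    rw [hX t ht, hY t ht, h1, h2, hBn]
    ring
  · have hc : Continuous fun s : ℝ => g s * Complex.exp (-A.ev n * s) := by fun_prop
    have hd := (((Complex.ofRealCLM.hasDerivAt (x := t)).const_mul (A.ev n)).cexp.mul
      (intervalIntegral.integral_hasDerivAt_right (hc.intervalIntegrable 0 t)
      (hc.stronglyMeasurableAtFilter _ _) hc.continuousAt)).mul_const (B j (A.eDom n))
    have h1 : Complex.exp (A.ev n * t) * Complex.exp (-A.ev n * t) = 1 := by
      rw [← Complex.exp_add]
      simp
    have h2 : ∑ i, (g t • EuclideanSpace.single j (1 : ℂ)) i * B i (A.eDom n) =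
        g t * B j (A.eDom n) := by
      simp
    refine hd.congr_deriv ?_
    simp only [h2, Complex.ofRealCLM_apply, Complex.ofReal_one]
    linear_combination (g t * B j (A.eDom n)) * h1
  · refine A.ext_dual fun n => ?_
    have hτ' : τ ∈ Set.Icc 0 τ := ⟨hτ, le_rfl⟩
    rw [add_apply, A.incl_coeff, A.incl_coeff, A.transpose_toImage_coeff, hX τ hτ', hY τ hτ']
    have h1 := (innerSL ℂ (A.e n)).intervalIntegral_comp_comm (a := 0) (b := τ)
      (hSc.intervalIntegrable (μ := MeasureTheory.volume) 0 τ)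
    refine Eq.trans ?_ h1
    rw [mul_left_comm, ← mul_add, ← hBn, ← intervalIntegral.integral_mul_const]
    refine intervalIntegral.integral_congr_ae (Eventually.of_forall fun r hr => ?_)
    rw [Set.uIoc_of_le hτ] at hr
    rw [innerSL_apply_apply, inner_smul_right, hS r hr.1, hg]
    simp only [sub_sub_cancel, mul_assoc]

/-! ### The test implies controllability -/

/-- The states in `H` reached from `0` at time `τ` by continuous controls. -/
def reachable (A : DiagonalParabolic H) {m : ℕ} (B : Fin m → A.Dual) (τ : ℝ) : Submodule ℂ H where
  carrier := {y | ∃ w, Continuous w ∧ ∃ u, A.IsSolution B τ 0 w u ∧ u τ = A.incl y}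
  add_mem' := by
    rintro y z ⟨w, hw, u, hu, huy⟩ ⟨x, hx, v, hv, hvz⟩
    refine ⟨w + x, hw.add hx, u + v, ?_, ?_⟩
    · simpa using hu.add hw hx hv
    · rw [Pi.add_apply, huy, hvz, map_add]
  zero_mem' := by
    refine ⟨0, continuous_zero, 0, ⟨continuousOn_const, fun φ ψ _ t _ => ?_⟩, by simp⟩
    simp
  smul_mem' := by
    rintro c y ⟨w, hw, u, hu, huy⟩
    refine ⟨c • w, hw.const_smul c, c • u, ?_, ?_⟩
    · simpa using hu.smul c
    · rw [Pi.smul_apply, huy, map_smul]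

/-- A state orthogonal to the reachable ones is orthogonal to the orbits `exp(t A) B_j`,
`0 < t < τ`. -/
theorem inner_orbit_eq_zero (A : DiagonalParabolic H) {m : ℕ} {B : Fin m → A.Dual} {τ : ℝ}
    (hτ : 0 < τ) {z : H} (hz : z ∈ (A.reachable B τ)ᗮ) {j : Fin m} {S : ℝ → H}
    (hSc : ContinuousOn S (Set.Ioi 0))
    (hS : ∀ t, 0 < t → ∀ n, inner ℂ (A.e n) (S t) = Complex.exp (A.ev n * t) * B j (A.eDom n))
    {t : ℝ} (ht : t ∈ Set.Ioo 0 τ) : inner ℂ z (S t) = 0 := by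
  have hSc' : ContinuousOn S (Set.Ioo 0 τ) := hSc.mono Set.Ioo_subset_Ioi_self
  have hF : ContinuousOn (fun r => inner ℂ z (S r)) (Set.Ioo 0 τ) :=
    (innerSL ℂ z).continuous.comp_continuousOn hSc'
  have hae := isOpen_Ioo.ae_eq_zero_of_integral_contDiff_smul_eq_zero
    (μ := MeasureTheory.volume) (hF.locallyIntegrableOn measurableSet_Ioo) fun h hh _ hsupp => by
      have hhc : Continuous fun r => (h r : ℂ) := Complex.continuous_ofReal.comp hh.continuous
      have hcont : Continuous fun r => (h r : ℂ) • S r := by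
        refine continuous_of_tsupport fun r hr => ?_
        have hr' : r ∈ Set.Ioo 0 τ := by
          refine hsupp (closure_mono (fun s hs => ?_) hr)
          intro h0
          exact hs (by simp [h0])
        exact hhc.continuousAt.smul (hSc'.continuousAt (isOpen_Ioo.mem_nhds hr'))
      obtain ⟨w, hw, u, hu, hy⟩ := A.exists_forced_solution B hτ.le j hhc hcont hS
      have h1 := (Submodule.mem_orthogonal' _ _).1 hz _ ⟨w, hw, u, hu, hy⟩
      have h2 := (innerSL ℂ z).intervalIntegral_comp_comm (a := 0) (b := τ)
        (hcont.intervalIntegrable (μ := MeasureTheory.volume) 0 τ)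
      rw [innerSL_apply_apply, h1] at h2
      rw [← h2, intervalIntegral.integral_eq_integral_of_support_subset]
      · simp only [innerSL_apply_apply, inner_smul_right]
        rfl
      · intro r hr
        have hr' : r ∈ Set.Ioo 0 τ := by
          refine hsupp (subset_tsupport _ ?_)
          intro h0
          exact hr (by simp [h0])
        exact ⟨hr'.1, hr'.2.le⟩
  exact MeasureTheory.Measure.eqOn_open_of_ae_eq (g := fun _ => 0)
    ((MeasureTheory.ae_restrict_iff' measurableSet_Ioo).2 hae) isOpen_Ioo hF continuousOn_const ht

/-- A nonzero state orthogonal to the reachable ones has a leading coefficient, and the component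
along the eigenspace of the latter fails the test. -/
theorem dense_reachable (A : DiagonalParabolic H) {m : ℕ} {B : Fin m → A.Dual} {τ : ℝ}
    (hτ : 0 < τ) (hB : A.FattoriniHautus B) : Dense (A.reachable B τ : Set H) := by
  classical
  rw [Submodule.dense_iff_topologicalClosure_eq_top, Submodule.topologicalClosure_eq_top_iff,
    Submodule.eq_bot_iff]
  intro z hz
  by_contra hz0
  have hex : ∃ n, inner ℂ (A.e n) z ≠ 0 := by
    by_contra! h
    exact hz0 (A.ext_coeff fun n => by rw [h n, inner_zero_right])
  set k := Nat.find hex with hk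
  have hk0 : inner ℂ (A.e k) z ≠ 0 := Nat.find_spec hex
  set v := A.eigenDom (A.ev k) fun n => inner ℂ (A.e n) z with hv
  have hv0 : v = 0 := by
    refine hB (A.ev k) v (A.adj_eigenDom _ _) fun j => ?_
    obtain ⟨S, hSc, hS⟩ := A.exists_smooth_orbit (B j)
    have hsum : ∀ t : ℝ, 0 < t → HasSum (fun n => inner ℂ z (A.e n) * B j (A.eDom n) *
        Complex.exp (A.ev n * t)) (inner ℂ z (S t)) := by
      intro t ht
      refine (A.e.hasSum_inner_mul_inner z (S t)).congr_fun fun n => ?_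
      rw [hS t ht]
      ring
    have h1 := A.tsum_leading_eq_zero (k := k) hτ (fun t ht => (hsum t ht).summable)
      (fun t ht => by rw [(hsum t ht.1).tsum_eq, A.inner_orbit_eq_zero hτ hz hSc hS ht])
      fun n hn => by
        have h2 : inner ℂ (A.e n) z = 0 := not_not.1 (Nat.find_min hex hn)
        rw [← inner_conj_symm, h2, map_zero, zero_mul]
    rw [tsum_eq_sum (s := (A.finite_ev_eq (A.ev k)).toFinset) fun n hn => if_neg (by
      simpa using hn)] at h1
    rw [hv, A.dual_eigenDom, ← h1]
    refine Finset.sum_congr rfl fun n hn => ?_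
    rw [if_pos (by simpa using hn), inner_conj_symm]
  have h3 := A.inner_eigenDom (A.ev k) (fun n => inner ℂ (A.e n) z) k
  rw [← hv, hv0, map_zero, inner_zero_right, if_pos rfl] at h3
  exact hk0 h3.symm

theorem isApproxControllable_of_fattoriniHautus (A : DiagonalParabolic H) {m : ℕ}
    {B : Fin m → A.Dual} {τ : ℝ} (hτ : 0 < τ) (hB : A.FattoriniHautus B) :
    A.IsApproxControllable B τ := by
  intro u₀ u₁ ε hε
  obtain ⟨v, hv, y₀, hvy⟩ := A.exists_free_solution B (τ := τ) u₀
  obtain ⟨y, hy, w, hw, u, hu, huy⟩ :=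
    Metric.dense_iff.1 (A.dense_reachable hτ hB) (u₁ - y₀) ε hε
  refine ⟨w, ?_, v + u, ?_, y₀ + y, by rw [Pi.add_apply, hvy, huy, map_add], ?_⟩
  · obtain ⟨C, hC⟩ := isCompact_Icc.exists_bound_of_continuousOn
      (hw.continuousOn (s := Set.Icc 0 τ))
    refine MeasureTheory.MemLp.of_bound hw.aestronglyMeasurable C ?_
    refine (MeasureTheory.ae_restrict_iff' measurableSet_Ioo).2 (Eventually.of_forall fun s hs => ?_)
    exact hC s ⟨hs.1.le, hs.2.le⟩
  · simpa using hv.add continuous_zero hw hu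
  · rw [Metric.mem_ball, dist_eq_norm] at hy
    calc ‖y₀ + y - u₁‖ = ‖y - (u₁ - y₀)‖ := by congr 1; abel
      _ ≤ ε := hy.le

end DiagonalParabolic

theorem theorem5p1 {H : Type*} [NormedAddCommGroup H] [InnerProductSpace ℂ H] [CompleteSpace H]
    (A : DiagonalParabolic H) (lam : ℝ) (hlam : 0 < lam)
    (P : A.FreqDecomposition lam) (B : Fin (A.maxMult lam) → A.Dual)
    (hB : DiagonalParabolic.IsFAdmissible P B) (τ : ℝ) (hτ : 0 < τ) :
    A.annihilator lam B = {0} ↔ A.IsApproxControllable B τ :=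
  ⟨fun h => A.isApproxControllable_of_fattoriniHautus hτ
    (DiagonalParabolic.fattoriniHautus_of_annihilator_eq hB h), fun h =>
    A.annihilator_eq_of_fattoriniHautus lam (A.fattoriniHautus_of_isApproxControllable hτ h)⟩
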